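/- Notation. $(x)_k=x(x+1)\cdots(x+k-1)$; $\mathbb N_0=\{0,1,2,\ldots\}$; ${}_pF_q(a_1,\ldots,a_p;b_1,\ldots,b_q)=\sum_{k\ge0}\frac{(a_1)_k\cdots(a_p)_k}{(b_1)_k\cdots(b_q)_k\,k!}$ is the generalized hypergeometric series at argument $1$ (if some upper parameter is $-N$ with $N\in\mathbb N_0$, it stops at $k=N$). Let $r\ge1$, let $m_1,\ldots,m_r$ be positive integers, $m=m_1+\cdots+m_r$, $\mathbf f=(f_1,\ldots,f_r)\in\mathbb C^r$, and write $\mathbf f+\mathbf m=(f_1+m_1,\ldots,f_r+m_r)$, $(\mathbf f)_{\mathbf m}=\prod_{i}(f_i)_{m_i}$. Put $$C_k=\frac1{(\mathbf f)_{\mathbf m}}\sum_{j=k}^m\sigma_jS_j^{(k)}\quad(0\le k\le m),\qquad\prod_{i=1}^r(f_i+x)_{m_i}=\sum_{j=0}^m\sigma_jx^j,$$ where $S_j^{(k)}$ are the Stirling numbers of the second kind. For complex $a,b$ define the polynomials $$R(t)=\sum_{k=0}^m(-1)^k(b)_kC_k\,(1-t-k)_{m-1},$$ $$\hat R(t)=\frac{(-m)(-b)C_0}{a-b}\,{}_3F_2\left(\begin{matrix}-m+1,\,t+1,\,1-b\\2,\,a-b+1\end{matrix}\right)+\sum_{k=1}^m\frac{(-1)^kC_k(a)_k(b)_k(t+1)_{k-1}}{(1)_{k-1}(a-b)_k}\,{}_3F_2\left(\begin{matrix}-m+k,\,t+k,\,-b\\k,\,a-b+k\end{matrix}\right),$$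 of degree at most $m-1$. Let $\lambda=(\lambda_1,\lambda_2,\ldots)$ be the roots of $R$ and $\gamma=(\gamma_1,\gamma_2,\ldots)$ the roots of $\hat R$, with multiplicity; there are $m-1$ of them when the degree is $m-1$. If the degree is smaller, the lists are shorter and the orders of the series on the right-hand sides below drop accordingly; for the zero polynomial the list is taken to be empty (the coefficient of the series is then $0$). (1) Let $n\in\mathbb N_0$ and $b,d,e\in\mathbb C$ with $b+m\notin-\mathbb N_0$, and $f_1\ne b$ if $m=r=1$. Suppose that the denominators do not vanish: $(e)_n$, $(e-d)_n$, $(f_i)_n$, $(f_i)_{m_i}$ $(1\le i\le r)$ and $(\lambda_i)_n$ (all $i$) are nonzero. Then $$\frac{(e)_n}{(e-d)_n}\,{}_{r+3}F_{r+2}\left(\begin{matrix}-n,\,b,\,d,\,\mathbf f+\mathbf m\\b+m,\,e,\,\mathbf f\end{matrix}\right)=\frac{(b)_m}{(\mathbf f)_{\mathbf m}}+\left(1-\frac{(b)_m}{(\mathbf f)_{\mathbf m}}\right){}_{m+2}F_{m+1}\left(\begin{matrix}-n,\,1,\,d,\,\lambda+1\\b+m,\,1-e+d-n,\,\lambda\end{matrix}\right).$$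 (2) Let $a,b,d,e\in\mathbb C$ with $a+m\notin-\mathbb N_0$, $a-b\notin\{1-m,\ldots,-1,0\}$, and $f_1\ne a$ if $m=r=1$. Suppose that none of $f_i$, $\gamma_i+1$, $e$, $e-b$, $e-d$, $e-b-d$ lies in $-\mathbb N_0$. Suppose also that $\Re(e-b-d)>0$ or one of $a,b,d$ lies in $-\mathbb N_0$, and that $\Re(e-d)>0$ or one of $a-b+1$, $d+1$ lies in $-\mathbb N_0$. Then both series below converge (absolutely) and $$\frac{\Gamma(e-d)\Gamma(e-b)}{\Gamma(e)\Gamma(e-b-d)}\,{}_{r+3}F_{r+2}\left(\begin{matrix}a,\,b,\,d,\,\mathbf f+\mathbf m\\a+m,\,e,\,\mathbf f\end{matrix}\right)=1+\frac{bd}{e-b}\left(\frac{a\prod_i(f_i+m_i)}{(a+m)\prod_if_i}-1\right){}_{m+2}F_{m+1}\left(\begin{matrix}1,\,a-b+1,\,d+1,\,\gamma+2\\a+m+1,\,e-b+1,\,\gamma+1\end{matrix}\right).$$ -/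

import Mathlib

open scoped Nat BigOperators

namespace ThomaeHyp

open Polynomial

/-- The rising factorial `(x)_k = x (x + 1) ⋯ (x + k - 1)`. -/
noncomputable def poch (x : ℂ) (k : ℕ) : ℂ := (ascPochhammer ℂ k).eval x

/-- `x ∈ -ℕ₀`, that is `x ∈ {0, -1, -2, …}`. -/
def IsNonposInt (x : ℂ) : Prop := ∃ N : ℕ, x = -(N : ℂ)

/-- The `k`-th term `(a₁)_k ⋯ (a_p)_k / ((b₁)_k ⋯ (b_q)_k k!) z ^ k` of the generalized
hypergeometric series with upper parameters `as` and lower parameters `bs`. -/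
noncomputable def hypTerm (as bs : Multiset ℂ) (z : ℂ) (k : ℕ) : ℂ :=
  (as.map fun a => poch a k).prod / ((bs.map fun b => poch b k).prod * (k ! : ℂ)) * z ^ k

/-- The generalized hypergeometric function `_pF_q(as; bs; z)` as the sum of its series.
(Unlike the regularized function, it makes sense for a terminating series some of whose lower
parameters are non-positive integers, as long as the vanishing denominators come after the
termination.) -/
noncomputable def hyp (as bs : Multiset ℂ) (z : ℂ) : ℂ := ∑' k : ℕ, hypTerm as bs z k

/-- The parameter vector `f = (f₁, …, f_r)` as a multiset. -/
def params {r : ℕ} (f : Fin r → ℂ) : Multiset ℂ := (Finset.univ : Finset (Fin r)).val.map f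

/-- The product `(f)_m = (f₁)_{m₁} ⋯ (f_r)_{m_r}`. -/
noncomputable def pochVec {r : ℕ} (f : Fin r → ℂ) (m : Fin r → ℕ) : ℂ := ∏ i, poch (f i) (m i)

/-- The polynomial `(f₁ + X)_{m₁} ⋯ (f_r + X)_{m_r}`, whose coefficients are the `σ_j`. -/
noncomputable def sigmaPoly {r : ℕ} (f : Fin r → ℂ) (m : Fin r → ℕ) : ℂ[X] :=
  ∏ i, (ascPochhammer ℂ (m i)).comp (C (f i) + X)

/-- The numbers `C_{k,r} = (1 / (f)_m) ∑_{j=k}^m σ_j S_j^{(k)}`, with `S_j^{(k)}` the Stirling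
numbers of the second kind. -/
noncomputable def Ccoeff {r : ℕ} (f : Fin r → ℂ) (m : Fin r → ℕ) (k : ℕ) : ℂ :=
  1 / pochVec f m *
    ∑ j ∈ Finset.Icc k (∑ i, m i), (sigmaPoly f m).coeff j * (Nat.stirlingSecond j k : ℂ)

/-- The polynomial
`R_{m-1}(t) = ∑_{k=0}^m (-1)^k (b)_k C_{k,r} (1 - t - k)_{m-1}`, where `m = m₁ + ⋯ + m_r`. -/
noncomputable def R {r : ℕ} (f : Fin r → ℂ) (m : Fin r → ℕ) (b : ℂ) : ℂ[X] :=
  ∑ k ∈ Finset.range ((∑ i, m i) + 1),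
    C ((-1) ^ k * poch b k * Ccoeff f m k) *
      (ascPochhammer ℂ ((∑ i, m i) - 1)).comp (C (1 - (k : ℂ)) - X)

/-- The polynomial `t ↦ ₃F₂(-N, t + s, u; v, w; 1)`. -/
noncomputable def poly3F2 (N : ℕ) (s u v w : ℂ) : ℂ[X] :=
  ∑ j ∈ Finset.range (N + 1),
    C (poch (-(N : ℂ)) j * poch u j / (poch v j * poch w j * (j ! : ℂ))) *
      (ascPochhammer ℂ j).comp (X + C s)

/-- The polynomial
`R̂_{m-1}(t) = (-m) (-b) C_{0,r} / (a - b) ₃F₂(-m+1, t+1, 1-b; 2, a-b+1)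
  + ∑_{k=1}^m (-1)^k C_{k,r} (a)_k (b)_k (t+1)_{k-1} / ((1)_{k-1} (a-b)_k)
      ₃F₂(-m+k, t+k, -b; k, a-b+k)`,
where `m = m₁ + ⋯ + m_r`. -/
noncomputable def Rhat {r : ℕ} (f : Fin r → ℂ) (m : Fin r → ℕ) (a b : ℂ) : ℂ[X] :=
  C ((-((∑ i, m i : ℕ) : ℂ)) * (-b) * Ccoeff f m 0 / (a - b)) *
      poly3F2 ((∑ i, m i) - 1) 1 (1 - b) 2 (a - b + 1) +
    ∑ k ∈ Finset.Icc 1 (∑ i, m i),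
      C ((-1) ^ k * Ccoeff f m k * poch a k * poch b k / (poch 1 (k - 1) * poch (a - b) k)) *
        (ascPochhammer ℂ (k - 1)).comp (X + 1) *
        poly3F2 ((∑ i, m i) - k) k (-b) k (a - b + k)

end ThomaeHyp

/-! Put `P(x) = ∏ (f_i + x)_{m_i}`. Since `(f + m)_k / (f)_k = (f + k)_m / (f)_m`, the pairs `f +
m`, `f` only insert the polynomial factor `P(k) / P(0)` into the `k`-th term of a `₃F₂`. The numbers
`C_k` are the coefficients of `P(x) / P(0)` in falling factorials (the Stirling numbers convert the
basis), and a falling factorial inside a binomial sum is absorbed by an index shift. Both parts thus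
reduce to classical sums without `P`.

Terminating case: clear `(e)_n`, expand `(e + k)_{n-k}` by Vandermonde as a sum of two rising
factorials, based at `d + k` and `e - d`, and interchange. The inner sum is the alternating binomial
sum of `(b)_k P(k) / ((b + M)_k P(0))`. By Chu–Vandermonde it equals `l! R(-l) / ((M-1)! (b + M)_l)`
for `l ≥ 1` (`sum_choose_sigmaPoly`). At `l = 0` it is `1`, whereas the formula gives `1 - (b)_M /
(f)_M`; the defect is the isolated constant on the right. Finally `R(-l) / R(0)` is a quotient of
rising factorials in the roots (`prod_poch_roots`).

Nonterminating case: let `h_k = (a)_k (b)_k P(k) / ((a + M)_k k! P(0))` and let `c_l` be the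
coefficients of `(1 - z)^b ∑ h_k z^k`. Sheppard's transformation gives `c_0 = 1` and `c_l = -(a-b)_l
R̂(-l) / (a + M)_l` for `l ≥ 1` (`sum_euler_sigmaPoly`). Expanding `h` through `c`, or `c` through
`h`, in a double series and summing the rows by Gauss's theorem transforms `∑ h_k (d)_k / (e)_k`
into a Gamma quotient times `∑ c_l (d)_l / (e-b)_l` (`tsum_eulerConv`). Splitting off `l = 0` and
shifting the index gives the right-hand side; its constant comes from computing `c_1` directly
(`Rhat_eval_neg_one`). Growth estimates or termination make at least one of the two double series
absolutely summable. -/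

namespace ThomaeHyp

open Polynomial Finset Filter Topology

/-! ### Rising factorials and the Chu–Vandermonde and Pfaff–Saalschütz sums. -/

section Pochhammer

@[simp] lemma poch_zero (x : ℂ) : poch x 0 = 1 := by simp [poch]

@[simp] lemma poch_one (x : ℂ) : poch x 1 = x := by simp [poch]

lemma poch_succ (x : ℂ) (k : ℕ) : poch x (k + 1) = poch x k * (x + k) := by
  simp [poch, ascPochhammer_succ_eval]

lemma poch_succ_left (x : ℂ) (k : ℕ) : poch x (k + 1) = x * poch (x + 1) k := by
  simp [poch, ascPochhammer_succ_left]

lemma poch_add (x : ℂ) (j k : ℕ) : poch x (j + k) = poch x j * poch (x + j) k := by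
  induction k with
  | zero => simp
  | succ k ih => rw [← add_assoc, poch_succ, ih, poch_succ]; push_cast; ring

lemma poch_one_left (k : ℕ) : poch 1 k = k ! := by
  simp [poch, ascPochhammer_eval_one]

lemma poch_zero_left {k : ℕ} (hk : k ≠ 0) : poch 0 k = 0 := by
  simp [poch, hk]

lemma poch_eq_zero_iff (x : ℂ) (k : ℕ) : poch x k = 0 ↔ ∃ j < k, x = -(j : ℂ) := by
  induction k with
  | zero => simp
  | succ k ih =>
    rw [poch_succ, mul_eq_zero, ih]
    constructor
    · rintro (⟨j, hj, h⟩ | h)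
      · exact ⟨j, by omega, h⟩
      · exact ⟨k, by omega, by linear_combination h⟩
    · rintro ⟨j, hj, h⟩
      rcases Nat.lt_succ_iff_lt_or_eq.mp hj with h' | rfl
      · exact Or.inl ⟨j, h', h⟩
      · right; rw [h]; ring

lemma poch_ne_zero {x : ℂ} (hx : ¬ IsNonposInt x) (k : ℕ) : poch x k ≠ 0 := fun h => by
  obtain ⟨j, -, hj⟩ := (poch_eq_zero_iff x k).mp h
  exact hx ⟨j, hj⟩

lemma poch_ne_zero_of_le {x : ℂ} {k n : ℕ} (h : poch x n ≠ 0) (hk : k ≤ n) : poch x k ≠ 0 := by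
  obtain ⟨i, rfl⟩ := Nat.exists_eq_add_of_le hk
  rw [poch_add] at h
  exact left_ne_zero_of_mul h

lemma IsNonposInt.of_add_nat {x : ℂ} {j : ℕ} (h : IsNonposInt (x + j)) : IsNonposInt x := by
  obtain ⟨N, hN⟩ := h
  exact ⟨N + j, by push_cast; linear_combination hN⟩

lemma poch_neg_nat_eq_zero {n k : ℕ} (h : n < k) : poch (-(n : ℂ)) k = 0 :=
  (poch_eq_zero_iff _ _).mpr ⟨n, h, rfl⟩

lemma poch_neg_nat_mul (j q : ℕ) :
    poch (-((j + q : ℕ) : ℂ)) j * (q ! : ℂ) = (-1) ^ j * ((j + q)! : ℂ) := by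
  induction j generalizing q with
  | zero => simp
  | succ j ih =>
    have := ih (q + 1)
    rw [show j + 1 + q = j + (q + 1) by ring, poch_succ, pow_succ]
    rw [Nat.factorial_succ q] at this
    push_cast at this ⊢
    linear_combination (-1) * this

/-- Reversal of a rising factorial. -/
lemma poch_reflect (x : ℂ) (k : ℕ) : poch (1 - x - k) k = (-1) ^ k * poch x k := by
  induction k generalizing x with
  | zero => simp
  | succ k ih =>
    rw [poch_succ, poch_succ_left x, pow_succ]
    have := ih (x + 1)
    rw [show (1 : ℂ) - (x + 1) - k = 1 - x - (k + 1 : ℕ) by push_cast; ring] at this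
    rw [this]; push_cast; ring

/-- The Chu–Vandermonde identity for rising factorials. -/
lemma poch_vandermonde (u v : ℂ) (N : ℕ) :
    ∑ p ∈ antidiagonal N, (N.choose p.1 : ℂ) * (poch u p.1 * poch v p.2) = poch (u + v) N := by
  induction N with
  | zero => simp
  | succ N ih =>
    rw [Finset.sum_antidiagonal_choose_succ_mul (fun k j => poch u k * poch v j), poch_succ, ← ih,
      Finset.sum_mul, ← Finset.sum_add_distrib]
    refine Finset.sum_congr rfl fun p hp => ?_
    have hp' := mem_antidiagonal.mp hp
    rw [Nat.choose_symm_of_eq_add (by omega : N = p.2 + p.1), poch_succ, poch_succ,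
      show (N : ℂ) = p.1 + p.2 by rw [← hp']; push_cast; ring]
    ring

/-- The Chu–Vandermonde identity as the evaluation of a terminating Gauss series. -/
lemma poch_vandermonde_sub (w x : ℂ) (N : ℕ) :
    ∑ p ∈ antidiagonal N, (N.choose p.1 : ℂ) * ((-1) ^ p.1 * poch x p.1 * poch (w + p.1) p.2) =
      poch (w - x) N := by
  induction N generalizing w x with
  | zero => simp
  | succ N ih =>
    rw [Finset.sum_antidiagonal_choose_succ_mul
      (fun k j => (-1) ^ k * poch x k * poch (w + k) j)]
    -- The factor `w - x + N` splits as `(w + N) - x`, matching the two halves of Pascal's rule; the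
    -- second half needs the induction hypothesis at `(w + 1, x + 1)`.
    rw [poch_succ, show poch (w - x) N * (w - x + N) = (w + N) * poch (w - x) N -
      x * poch (w + 1 - (x + 1)) N by rw [add_sub_add_right_eq_sub]; ring, ← ih, ← ih,
      Finset.mul_sum, Finset.mul_sum, ← Finset.sum_add_distrib, ← Finset.sum_sub_distrib]
    refine Finset.sum_congr rfl fun p hp => ?_
    have hp' := mem_antidiagonal.mp hp
    rw [Nat.choose_symm_of_eq_add (by omega : N = p.2 + p.1), poch_succ, poch_succ_left x,
      show (N : ℂ) = p.1 + p.2 by rw [← hp']; push_cast; ring]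
    push_cast
    rw [show w + ((p.1 : ℂ) + 1) = w + 1 + p.1 by ring]
    ring

/-- The Pfaff–Saalschütz theorem, with denominators cleared. -/
lemma pfaff_saalschutz (A B s : ℂ) (N : ℕ) :
    ∑ p ∈ antidiagonal N, (N.choose p.1 : ℂ) *
        (poch s p.2 * poch A p.1 * poch B p.1 * poch (A + B + s + p.1) p.2) =
      poch (A + s) N * poch (B + s) N := by
  induction N with
  | zero => simp
  | succ N ih =>
    -- After Pascal's rule the inductive step fails termwise only by this difference. It vanishes in
    -- total: moving the index by one, the weight `k` on the left is matched with the weight from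
    -- `(w + 1)_q - (w)_q = q (w + 1)_{q-1}`.
    have key : ∑ p ∈ antidiagonal N, (N.choose p.1 : ℂ) * (p.1 * ((s + p.2) *
          (poch s p.2 * poch A p.1 * poch B p.1 * poch (A + B + s + p.1) p.2))) =
        ∑ p ∈ antidiagonal N, (N.choose p.1 : ℂ) * (poch s p.2 * poch A (p.1 + 1) *
          poch B (p.1 + 1) * (poch (A + B + s + p.1 + 1) p.2 - poch (A + B + s + p.1) p.2)) := by
      cases N with
      | zero => simp
      | succ N =>
        rw [Finset.Nat.sum_antidiagonal_succ, Finset.Nat.sum_antidiagonal_succ']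
        simp only [Nat.cast_zero, zero_mul, mul_zero, zero_add, poch_zero, sub_self, add_zero]
        refine Finset.sum_congr rfl fun p hp => ?_
        have hp' := mem_antidiagonal.mp hp
        have hc : ((N + 1).choose p.1 : ℂ) * (p.2 + 1) = (N + 1).choose (p.1 + 1) * (p.1 + 1) := by
          have := Nat.choose_succ_right_eq (N + 1) p.1
          rw [show N + 1 - p.1 = p.2 + 1 by omega] at this
          exact_mod_cast this.symm
        rw [poch_succ_left (A + B + s + p.1), poch_succ (A + B + s + p.1 + 1), poch_succ s]
        push_cast
        rw [show A + B + s + ((p.1 : ℂ) + 1) = A + B + s + p.1 + 1 by ring]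
        linear_combination (-(poch s p.2 * (s + p.2) * poch A (p.1 + 1) * poch B (p.1 + 1) *
          poch (A + B + s + p.1 + 1) p.2)) * hc
    rw [Finset.sum_antidiagonal_choose_succ_mul
      (fun k j => poch s j * poch A k * poch B k * poch (A + B + s + k) j), poch_succ, poch_succ,
      mul_mul_mul_comm, ← ih, Finset.sum_mul, ← Finset.sum_add_distrib]
    rw [← sub_eq_zero, ← Finset.sum_sub_distrib] at key ⊢
    rw [← neg_eq_zero, ← key, ← Finset.sum_neg_distrib]
    refine Finset.sum_congr rfl fun p hp => ?_
    have hp' := mem_antidiagonal.mp hp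
    rw [Nat.choose_symm_of_eq_add (by omega : N = p.2 + p.1), poch_succ, poch_succ, poch_succ,
      poch_succ, show (N : ℂ) = p.1 + p.2 by rw [← hp']; push_cast; ring]
    push_cast
    rw [show A + B + s + ((p.1 : ℂ) + 1) = A + B + s + p.1 + 1 by ring]
    ring

end Pochhammer

/-! ### Rearranging finite double sums; Sheppard's transformation. -/

section Antidiagonal

lemma sum_antidiagonal_rotate {α : Type*} [AddCommMonoid α] (N : ℕ) (F : ℕ → ℕ → ℕ → α) :
    ∑ x ∈ antidiagonal N, ∑ y ∈ antidiagonal x.2, F x.1 y.1 y.2 =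
      ∑ x ∈ antidiagonal N, ∑ y ∈ antidiagonal x.1, F y.1 y.2 x.2 := by
  rw [Finset.sum_sigma', Finset.sum_sigma']
  refine Finset.sum_nbij' (fun x => ⟨(x.1.1 + x.2.1, x.2.2), (x.1.1, x.2.1)⟩)
    (fun x => ⟨(x.2.1, x.2.2 + x.1.2), (x.2.2, x.1.2)⟩) ?_ ?_ ?_ ?_ ?_ <;>
  rintro ⟨⟨a, b⟩, ⟨c, d⟩⟩ h <;> simp only [mem_sigma, HasAntidiagonal.mem_antidiagonal] at h <;>
  obtain ⟨h1, h2⟩ := h <;> subst h1 <;> subst h2 <;> simp [add_assoc]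

lemma sum_antidiagonal_swap_left {α : Type*} [AddCommMonoid α] (N : ℕ) (F : ℕ → ℕ → ℕ → α) :
    ∑ x ∈ antidiagonal N, ∑ y ∈ antidiagonal x.2, F x.1 y.1 y.2 =
      ∑ x ∈ antidiagonal N, ∑ y ∈ antidiagonal x.2, F y.1 x.1 y.2 := by
  rw [sum_antidiagonal_rotate, sum_antidiagonal_rotate N (fun a b c => F b a c)]
  exact Finset.sum_congr rfl fun x _ =>
    (Finset.Nat.sum_antidiagonal_swap (f := fun y => F y.1 y.2 x.2)).symm

lemma choose_mul_choose_comm (k p j : ℕ) :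
    ((k + (p + j)).choose k : ℂ) * (p + j).choose p =
      (p + (k + j)).choose p * (k + j).choose k := by
  rw [Nat.cast_add_choose, Nat.cast_add_choose, Nat.cast_add_choose, Nat.cast_add_choose,
    show p + (k + j) = k + (p + j) by ring]
  have h := fun n : ℕ => (Nat.cast_ne_zero.mpr n.factorial_ne_zero : (n ! : ℂ) ≠ 0)
  have := h k; have := h p; have := h j; have := h (p + j); have := h (k + j)
  field_simp

lemma choose_mul_choose_assoc (k p j : ℕ) :
    ((k + (p + j)).choose k : ℂ) * (p + j).choose p =
      ((k + p) + j).choose (k + p) * (k + p).choose k := by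
  rw [Nat.cast_add_choose, Nat.cast_add_choose, Nat.cast_add_choose, Nat.cast_add_choose,
    show k + p + j = k + (p + j) by ring]
  have h := fun n : ℕ => (Nat.cast_ne_zero.mpr n.factorial_ne_zero : (n ! : ℂ) ≠ 0)
  have := h k; have := h p; have := h j; have := h (p + j); have := h (k + p)
  field_simp

/-- Absorption: `C(n, k)` times the `j`-th falling factorial of `k` is the `j`-th falling factorial
of `n` times `C(n - j, k - j)`. -/
lemma sum_choose_mul_descFactorial (i j : ℕ) (F : ℕ → ℕ → ℂ) :
    ∑ p ∈ antidiagonal (j + i), ((j + i).choose p.1 : ℂ) * (p.1.descFactorial j * F p.1 p.2) =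
      (j + i).descFactorial j *
        ∑ p ∈ antidiagonal i, (i.choose p.1 : ℂ) * F (j + p.1) p.2 := by
  induction j generalizing F with
  | zero => simp
  | succ j ih =>
    have h := ih (fun k q => F (k + 1) q)
    rw [show j + 1 + i = j + i + 1 by ring, Finset.Nat.sum_antidiagonal_succ,
      Nat.succ_descFactorial_succ]
    push_cast
    rw [mul_assoc]
    simp only [add_right_comm j 1, ← h, Finset.mul_sum]
    rw [Nat.zero_descFactorial_succ, Nat.cast_zero, zero_mul, mul_zero, zero_add]
    refine Finset.sum_congr rfl fun p _ => ?_
    have hc : ((j + i + 1 : ℕ) : ℂ) * (j + i).choose p.1 =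
        (j + i + 1).choose (p.1 + 1) * (p.1 + 1 : ℕ) := by
      exact_mod_cast Nat.add_one_mul_choose_eq (j + i) p.1
    rw [Nat.succ_descFactorial_succ]
    push_cast at hc ⊢
    linear_combination (-(p.1.descFactorial j : ℂ) * F (p.1 + 1) p.2) * hc

lemma sum_choose_mul_descFactorial_of_lt {l j : ℕ} (h : l < j) (F : ℕ → ℕ → ℂ) :
    ∑ p ∈ antidiagonal l, (l.choose p.1 : ℂ) * (p.1.descFactorial j * F p.1 p.2) = 0 := by
  refine Finset.sum_eq_zero fun p hp => ?_
  have hp' := mem_antidiagonal.mp hp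
  rw [Nat.descFactorial_eq_zero_iff_lt.mpr (by omega)]
  simp

/-- Sheppard's transformation of terminating `₃F₂` series, with denominators cleared. -/
lemma sheppard (A B C s : ℂ) (N : ℕ) :
    ∑ x ∈ antidiagonal N, (N.choose x.1 : ℂ) *
        (poch s x.2 * poch A x.1 * poch B x.1 * poch (C + x.1) x.2) =
      ∑ x ∈ antidiagonal N, (N.choose x.1 : ℂ) * ((-1) ^ x.1 * poch s x.1 *
        poch (A + B + s - C) x.1 * poch (A + s + x.1) x.2 * poch (B + s + x.1) x.2) := by
  set X := A + B + s - C with hX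
  have hl : ∀ x ∈ antidiagonal N, (N.choose x.1 : ℂ) *
        (poch s x.2 * poch A x.1 * poch B x.1 * poch (C + x.1) x.2) =
      ∑ y ∈ antidiagonal x.2, ((x.1 + (y.1 + y.2)).choose x.1 : ℂ) * (y.1 + y.2).choose y.1 *
        (poch s (y.1 + y.2) * poch A x.1 * poch B x.1 *
          ((-1) ^ y.1 * poch X y.1 * poch (A + B + s + x.1 + y.1) y.2)) := by
    intro x hx
    -- Re-expanding around `A + B + s` rather than `C` makes the inner sum, after the interchange,
    -- exactly the balanced one of `pfaff_saalschutz`.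
    rw [show C + x.1 = (A + B + s + x.1) - X by rw [hX]; ring, ← poch_vandermonde_sub,
      Finset.mul_sum, Finset.mul_sum]
    refine Finset.sum_congr rfl fun y hy => ?_
    rw [mem_antidiagonal.mp hy, mem_antidiagonal.mp hx]
    ring
  have hr : ∀ x ∈ antidiagonal N, (N.choose x.1 : ℂ) * ((-1) ^ x.1 * poch s x.1 *
        poch X x.1 * poch (A + s + x.1) x.2 * poch (B + s + x.1) x.2) =
      ∑ y ∈ antidiagonal x.2, ((y.1 + (x.1 + y.2)).choose y.1 : ℂ) * (x.1 + y.2).choose x.1 *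
        (poch s (x.1 + y.2) * poch A y.1 * poch B y.1 *
          ((-1) ^ x.1 * poch X x.1 * poch (A + B + s + y.1 + x.1) y.2)) := by
    intro x hx
    rw [mul_assoc _ (poch (A + s + x.1) x.2), add_assoc A, add_assoc B, ← pfaff_saalschutz,
      Finset.mul_sum, Finset.mul_sum]
    refine Finset.sum_congr rfl fun y hy => ?_
    rw [choose_mul_choose_comm, mem_antidiagonal.mp hy, mem_antidiagonal.mp hx, poch_add s,
      show A + B + (s + x.1) + y.1 = A + B + s + y.1 + x.1 by ring]
    ring
  rw [Finset.sum_congr rfl hl, Finset.sum_congr rfl hr]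
  exact sum_antidiagonal_swap_left N fun k p j =>
    ((k + (p + j)).choose k : ℂ) * (p + j).choose p * (poch s (p + j) * poch A k * poch B k *
          ((-1) ^ p * poch X p * poch (A + B + s + k + p) j))

end Antidiagonal

/-! ### The polynomial `P` in the basis of falling factorials. -/

section Stirling

/-- Multiplying the `k`-th falling factorial of `x` by `x = k + (x - k)` reproduces the Stirling
recurrence. -/
lemma natCast_pow_eq_sum_stirlingSecond (x j : ℕ) :
    (x : ℂ) ^ j = ∑ k ∈ range (j + 1), (Nat.stirlingSecond j k : ℂ) * x.descFactorial k := by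
  induction j with
  | zero => simp
  | succ j ih =>
    rw [pow_succ, ih, Finset.sum_range_succ' _ (j + 1), Finset.sum_mul]
    have hx : ∀ k, (x.descFactorial k : ℂ) * x =
        k * x.descFactorial k + x.descFactorial (k + 1) := by
      intro k
      rcases le_or_gt k x with h | h
      · rw [Nat.descFactorial_succ]; push_cast [Nat.cast_sub h]; ring
      · rw [Nat.descFactorial_eq_zero_iff_lt.mpr h,
          Nat.descFactorial_eq_zero_iff_lt.mpr (by omega)]; simp
    have haux : ∑ k ∈ range (j + 1), (Nat.stirlingSecond j k : ℂ) * (k * x.descFactorial k) =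
        ∑ k ∈ range (j + 1), (Nat.stirlingSecond j (k + 1) : ℂ) *
          ((k + 1 : ℕ) * x.descFactorial (k + 1)) := by
      rw [Finset.sum_range_succ' _ j, Finset.sum_range_succ _ j,
        Nat.stirlingSecond_eq_zero_of_lt (Nat.lt_succ_self j)]
      simp
    simp only [mul_assoc, hx, mul_add, Finset.sum_add_distrib]
    rw [haux, ← Finset.sum_add_distrib, Nat.stirlingSecond_succ_zero, Nat.cast_zero, zero_mul,
      add_zero]
    refine Finset.sum_congr rfl fun k _ => ?_
    rw [Nat.stirlingSecond_succ_succ]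
    push_cast; ring

variable {r : ℕ} (f : Fin r → ℂ) (m : Fin r → ℕ)

lemma sigmaPoly_eval (x : ℂ) : (sigmaPoly f m).eval x = ∏ i, poch (f i + x) (m i) := by
  simp [sigmaPoly, eval_prod, poch]

lemma sigmaPoly_eval_zero : (sigmaPoly f m).eval 0 = pochVec f m := by
  simp [sigmaPoly_eval, pochVec]

lemma sigmaPoly_monic : (sigmaPoly f m).Monic := by
  unfold sigmaPoly
  refine monic_prod_of_monic _ _ fun i _ => ?_
  rw [add_comm (C (f i))]
  exact (monic_ascPochhammer ℂ (m i)).comp_X_add_C _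

lemma sigmaPoly_natDegree : (sigmaPoly f m).natDegree = ∑ i, m i := by
  rw [sigmaPoly, natDegree_prod_of_monic]
  · refine Finset.sum_congr rfl fun i _ => ?_
    rw [natDegree_comp, ascPochhammer_natDegree, add_comm, natDegree_X_add_C, mul_one]
  · intro i _
    rw [add_comm]
    exact (monic_ascPochhammer ℂ (m i)).comp_X_add_C _

/-- The `Ccoeff` are the coefficients in the basis of falling factorials. -/
lemma sigmaPoly_eval_natCast (h : pochVec f m ≠ 0) (x : ℕ) :
    (sigmaPoly f m).eval (x : ℂ) =
      pochVec f m * ∑ k ∈ range (∑ i, m i + 1), Ccoeff f m k * x.descFactorial k := by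
  rw [eval_eq_sum_range, sigmaPoly_natDegree, Finset.mul_sum]
  set M := ∑ i, m i with hM
  have h1 : ∀ j ∈ range (M + 1), (sigmaPoly f m).coeff j * (x : ℂ) ^ j =
      ∑ k ∈ range (j + 1),
        (sigmaPoly f m).coeff j * ((Nat.stirlingSecond j k : ℂ) * x.descFactorial k) := by
    intro j _
    rw [natCast_pow_eq_sum_stirlingSecond, Finset.mul_sum]
  rw [Finset.sum_congr rfl h1, Finset.sum_comm' (t' := range (M + 1)) (s' := fun k => Icc k M)]
  · refine Finset.sum_congr rfl fun k _ => ?_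
    rw [Ccoeff, ← mul_assoc, ← mul_assoc, mul_one_div_cancel h, one_mul, Finset.sum_mul]
    exact Finset.sum_congr rfl fun j _ => by ring
  · intro j k
    simp only [Finset.mem_range, Finset.mem_Icc]
    omega

lemma Ccoeff_zero (h : pochVec f m ≠ 0) : Ccoeff f m 0 = 1 := by
  have := sigmaPoly_eval_natCast f m h 0
  rw [Nat.cast_zero, sigmaPoly_eval_zero, Finset.sum_range_succ'] at this
  simpa [h] using this

lemma Ccoeff_last : Ccoeff f m (∑ i, m i) = 1 / pochVec f m := by
  have := sigmaPoly_monic f m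
  rw [Monic, leadingCoeff, sigmaPoly_natDegree] at this
  simp [Ccoeff, this, Nat.stirlingSecond_self]

end Stirling

/-! ### Hypergeometric terms as simpler terms times polynomial values. -/

section Terms

/-- Factor `Q` over its roots and use `x (x + 1)_k = (x)_k (x + k)` at `x = g + c`; the signs agree
on both sides. Undivided, the identity also covers `Q(-c) = 0` and `Q = 0`. It serves `R` with `c =
0` and `R̂` with `c = 1`. -/
lemma prod_poch_roots (Q : ℂ[X]) (c : ℂ) (k : ℕ) :
    (Q.roots.map fun g => poch (g + (c + 1)) k).prod * Q.eval (-c) =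
      (Q.roots.map fun g => poch (g + c) k).prod * Q.eval (-c - k) := by
  have hQ := IsAlgClosed.splits Q
  rw [hQ.eval_eq_prod_roots, hQ.eval_eq_prod_roots, mul_left_comm, mul_left_comm _ Q.leadingCoeff,
    ← Multiset.prod_map_mul, ← Multiset.prod_map_mul]
  congr 3
  funext g
  have := (poch_succ (g + c) k).symm.trans (poch_succ_left (g + c) k)
  rw [← add_assoc]
  linear_combination this

variable {r : ℕ} (f : Fin r → ℂ) (m : Fin r → ℕ)

lemma prod_params (g : Fin r → ℂ) (k : ℕ) :
    ((params g).map fun a => poch a k).prod = ∏ i, poch (g i) k := by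
  simp only [params, Multiset.map_map]
  rfl

/-- Both `(f)_m (f + m)_k` and `(f)_k (f + k)_m` equal `(f)_{m+k}`. -/
lemma prod_poch_params (k : ℕ) :
    (∏ i, poch (f i + m i) k) * pochVec f m = (∏ i, poch (f i) k) * (sigmaPoly f m).eval (k : ℂ) := by
  rw [pochVec, sigmaPoly_eval, ← Finset.prod_mul_distrib, ← Finset.prod_mul_distrib]
  refine Finset.prod_congr rfl fun i _ => ?_
  rw [mul_comm, ← poch_add, ← poch_add, add_comm]

lemma hypTerm_add (as bs as' bs' : Multiset ℂ) (k : ℕ) :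
    hypTerm (as + as') (bs + bs') 1 k = hypTerm as bs 1 k *
      ((as'.map fun a => poch a k).prod / (bs'.map fun b => poch b k).prod) := by
  simp only [hypTerm, Multiset.map_add, Multiset.prod_add, one_pow, mul_one]
  rw [mul_right_comm, mul_div_mul_comm]

lemma hypTerm_params (as bs : Multiset ℂ) (k : ℕ) (hk : ∀ i, poch (f i) k ≠ 0)
    (h : pochVec f m ≠ 0) :
    hypTerm (as + params fun i => f i + m i) (bs + params f) 1 k =
      hypTerm as bs 1 k * ((sigmaPoly f m).eval (k : ℂ) / pochVec f m) := by
  rw [hypTerm_add, prod_params, prod_params]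
  congr 1
  rw [div_eq_div_iff (Finset.prod_ne_zero_iff.mpr fun i _ => hk i) h, prod_poch_params, mul_comm]

lemma hypTerm_three_two (x y z u v : ℂ) (k : ℕ) :
    hypTerm {x, y, z} {u, v} 1 k =
      poch x k * poch y k * poch z k / (poch u k * poch v k * k !) := by
  simp [hypTerm, Multiset.insert_eq_cons, mul_assoc]

end Terms

/-! ### Values of `R` at non-positive integers. -/

section RPolynomial

variable {r : ℕ} (f : Fin r → ℂ) (m : Fin r → ℕ)

lemma R_eval {N : ℕ} (hN : ∑ i, m i = N + 1) (b t : ℂ) :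
    (R f m b).eval t = ∑ k ∈ range (N + 1 + 1),
      (-1) ^ k * poch b k * Ccoeff f m k * poch (1 - k - t) N := by
  simp [R, eval_finsetSum, poch, hN]

lemma R_eval_zero {N : ℕ} (hN : ∑ i, m i = N + 1) (h : pochVec f m ≠ 0) (b : ℂ) :
    (R f m b).eval 0 = (N ! : ℂ) * (1 - poch b (N + 1) / pochVec f m) := by
  have hlast : poch (-(N : ℂ)) N = (-1) ^ N * (N ! : ℂ) := by
    simpa using poch_neg_nat_mul N 0
  have hC := Ccoeff_last f m
  rw [hN] at hC
  -- At `t = 0` the factor `(1 - k)_N` vanishes for `1 ≤ k ≤ N`, so only the two extreme terms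
  -- survive.
  rw [R_eval f m hN, Finset.sum_range_succ, Finset.sum_range_succ', Finset.sum_eq_zero, hC,
    Ccoeff_zero f m h, show (1 : ℂ) - (N + 1 : ℕ) - 0 = -N by push_cast; ring, hlast]
  · simp only [zero_add, pow_zero, poch_zero, Nat.cast_zero, sub_zero, poch_one_left, pow_succ]
    have : ((-1 : ℂ) ^ N) * (-1) ^ N = 1 := by rw [← mul_pow]; simp
    linear_combination (-(N ! : ℂ) * poch b (N + 1) / pochVec f m) * this
  · intro k hk
    rw [show (1 : ℂ) - (k + 1 : ℕ) - 0 = -k by push_cast; ring,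
      poch_neg_nat_eq_zero (Finset.mem_range.mp hk), mul_zero]

/-- For `j ≤ l`, shift the index by `j` and apply Chu–Vandermonde. For `j > l` both sides vanish;
this uses `l ≥ 1`, since at `l = 0`, `j = N + 1` the factor `(-N)_N` is nonzero. That exception
produces the constant `(b)_M / (f)_M` of the terminating formula. -/
lemma sum_choose_descFactorial_poch (b : ℂ) {N l j : ℕ} (hl : 1 ≤ l) (hj : j ≤ N + 1) :
    (∑ p ∈ antidiagonal l, (l.choose p.1 : ℂ) * (p.1.descFactorial j *
        ((-1) ^ p.1 * poch b p.1 * poch (b + (N + 1 : ℕ) + p.1) p.2))) * (N ! : ℂ) =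
      (l ! : ℂ) * ((-1) ^ j * poch b j * poch (1 - j + l) N) := by
  rcases lt_or_ge l j with h | h
  · rw [sum_choose_mul_descFactorial_of_lt h
      (fun k q => (-1) ^ k * poch b k * poch (b + (N + 1 : ℕ) + k) q)]
    have : poch (1 - (j : ℂ) + l) N = 0 := by
      rw [show (1 : ℂ) - j + l = -((j - l - 1 : ℕ) : ℂ) by
        rw [Nat.cast_sub (by omega), Nat.cast_sub (by omega)]; push_cast; ring]
      exact poch_neg_nat_eq_zero (by omega)
    rw [this]; ring
  · obtain ⟨i, rfl⟩ := Nat.exists_eq_add_of_le h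
    have hs : ∀ p : ℕ × ℕ, (i.choose p.1 : ℂ) * ((-1) ^ (j + p.1) * poch b (j + p.1) *
          poch (b + (N + 1 : ℕ) + (j + p.1 : ℕ)) p.2) =
        ((-1) ^ j * poch b j) * ((i.choose p.1 : ℂ) * ((-1) ^ p.1 * poch (b + j) p.1 *
          poch (b + (N + 1 : ℕ) + j + p.1) p.2)) := by
      intro p
      rw [poch_add b, pow_add, Nat.cast_add j, ← add_assoc]; ring
    rw [sum_choose_mul_descFactorial i j
      (fun k q => (-1) ^ k * poch b k * poch (b + (N + 1 : ℕ) + k) q),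
      Finset.sum_congr rfl fun p _ => hs p, ← Finset.mul_sum, poch_vandermonde_sub,
      show b + (N + 1 : ℕ) + j - (b + j) = (1 + N : ℂ) by push_cast; ring,
      show (1 : ℂ) - j + (j + i : ℕ) = 1 + i by push_cast; ring]
    have h1 : poch 1 (N + i) = N ! * poch (1 + N) i := by rw [poch_add, poch_one_left]
    have h2 : poch 1 (i + N) = i ! * poch (1 + i) N := by rw [poch_add, poch_one_left]
    have h3 : (i ! : ℂ) * (j + i).descFactorial j = (j + i)! := by
      exact_mod_cast (by simpa using Nat.factorial_mul_descFactorial (Nat.le_add_right j i))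
    rw [add_comm N i] at h1
    linear_combination ((-1) ^ j * poch b j * ((j + i).descFactorial j : ℂ)) * (h2 - h1) +
      ((-1) ^ j * poch b j * poch (1 + i) N) * h3

lemma sum_choose_sigmaPoly {N : ℕ} (hN : ∑ i, m i = N + 1) (h : pochVec f m ≠ 0) (b : ℂ) {l : ℕ}
    (hl : 1 ≤ l) :
    (∑ p ∈ antidiagonal l, (l.choose p.1 : ℂ) * ((-1) ^ p.1 * poch b p.1 *
        poch (b + (N + 1 : ℕ) + p.1) p.2 * ((sigmaPoly f m).eval (p.1 : ℂ) / pochVec f m))) *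
        (N ! : ℂ) =
      (l ! : ℂ) * (R f m b).eval (-(l : ℂ)) := by
  rw [R_eval f m hN, Finset.mul_sum]
  have hP : ∀ k : ℕ, (sigmaPoly f m).eval (k : ℂ) / pochVec f m =
      ∑ j ∈ range (N + 1 + 1), Ccoeff f m j * k.descFactorial j := by
    intro k
    rw [sigmaPoly_eval_natCast f m h, mul_div_cancel_left₀ _ h, hN]
  simp only [hP, Finset.mul_sum]
  rw [Finset.sum_comm, Finset.sum_mul]
  refine Finset.sum_congr rfl fun j hj => ?_
  have := sum_choose_descFactorial_poch b hl (Nat.lt_succ_iff.mp (Finset.mem_range.mp hj))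
  rw [sub_neg_eq_add, show (l ! : ℂ) * ((-1) ^ j * poch b j * Ccoeff f m j * poch (1 - j + l) N) =
    Ccoeff f m j * (l ! * ((-1) ^ j * poch b j * poch (1 - j + l) N)) by ring, ← this,
    ← mul_assoc, Finset.mul_sum]
  congr 1
  exact Finset.sum_congr rfl fun p _ => by ring

end RPolynomial

/-! ### The terminating transformation. -/

section Terminating

lemma hypTerm_eq_zero_of_neg_nat {as bs : Multiset ℂ} {n k : ℕ} (h : -(n : ℂ) ∈ as) (hk : n < k) :
    hypTerm as bs 1 k = 0 := by
  rw [hypTerm, Multiset.prod_eq_zero, zero_div, zero_mul]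
  exact Multiset.mem_map.mpr ⟨_, h, poch_neg_nat_eq_zero hk⟩

lemma hyp_eq_sum_of_neg_nat {as bs : Multiset ℂ} {n : ℕ} (h : -(n : ℂ) ∈ as) :
    hyp as bs 1 = ∑ p ∈ antidiagonal n, hypTerm as bs 1 p.1 := by
  rw [hyp, tsum_eq_sum (s := range (n + 1)), Finset.Nat.sum_antidiagonal_eq_sum_range_succ_mk]
  intro k hk
  exact hypTerm_eq_zero_of_neg_nat h (by simpa using hk)

lemma poch_neg_nat_div_factorial (k q : ℕ) :
    poch (-((k + q : ℕ) : ℂ)) k / (k ! : ℂ) = (-1) ^ k * (k + q).choose k := by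
  have h := fun n : ℕ => (Nat.cast_ne_zero.mpr n.factorial_ne_zero : (n ! : ℂ) ≠ 0)
  rw [Nat.cast_add_choose, div_eq_iff (h k)]
  have := poch_neg_nat_mul k q
  have := h k; have := h q
  field_simp
  assumption

/-- A terminating series with denominators cleared, expanded by the Vandermonde identity. -/
lemma sum_choose_expand (n : ℕ) (d e : ℂ) (g : ℕ → ℂ) :
    ∑ p ∈ antidiagonal n, (n.choose p.1 : ℂ) * ((-1) ^ p.1 * g p.1 * poch d p.1 *
        poch (e + p.1) p.2) =
      ∑ p ∈ antidiagonal n, (n.choose p.1 : ℂ) * (poch d p.1 * poch (e - d) p.2 *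
        ∑ y ∈ antidiagonal p.1, (p.1.choose y.1 : ℂ) * ((-1) ^ y.1 * g y.1)) := by
  have hl : ∀ x ∈ antidiagonal n, (n.choose x.1 : ℂ) * ((-1) ^ x.1 * g x.1 * poch d x.1 *
        poch (e + x.1) x.2) =
      ∑ y ∈ antidiagonal x.2, ((x.1 + (y.1 + y.2)).choose x.1 : ℂ) * (y.1 + y.2).choose y.1 *
        ((-1) ^ x.1 * g x.1 * poch d (x.1 + y.1) * poch (e - d) y.2) := by
    intro x hx
    rw [show e + x.1 = (d + x.1) + (e - d) by ring, ← poch_vandermonde, Finset.mul_sum,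
      Finset.mul_sum]
    refine Finset.sum_congr rfl fun y hy => ?_
    rw [mem_antidiagonal.mp hy, mem_antidiagonal.mp hx, poch_add d]
    ring
  have hr : ∀ x ∈ antidiagonal n, (n.choose x.1 : ℂ) * (poch d x.1 * poch (e - d) x.2 *
        ∑ y ∈ antidiagonal x.1, (x.1.choose y.1 : ℂ) * ((-1) ^ y.1 * g y.1)) =
      ∑ y ∈ antidiagonal x.1, ((y.1 + (y.2 + x.2)).choose y.1 : ℂ) * (y.2 + x.2).choose y.2 *
        ((-1) ^ y.1 * g y.1 * poch d (y.1 + y.2) * poch (e - d) x.2) := by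
    intro x hx
    rw [Finset.mul_sum, Finset.mul_sum]
    refine Finset.sum_congr rfl fun y hy => ?_
    rw [choose_mul_choose_assoc, mem_antidiagonal.mp hy, mem_antidiagonal.mp hx]
    ring
  rw [Finset.sum_congr rfl hl, Finset.sum_congr rfl hr]
  exact sum_antidiagonal_rotate n fun k p j => ((k + (p + j)).choose k : ℂ) * (p + j).choose p *
    ((-1) ^ k * g k * poch d (k + p) * poch (e - d) j)

theorem thomae_terminating {r : ℕ} (f : Fin r → ℂ) (m : Fin r → ℕ) {M : ℕ} (hM : ∑ i, m i = M)
    (hM1 : 1 ≤ M) (n : ℕ) (b d e : ℂ) (hb : ¬ IsNonposInt (b + M))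
    (hf : ∀ i, poch (f i) n ≠ 0 ∧ poch (f i) (m i) ≠ 0) (he : poch e n ≠ 0)
    (hed : poch (e - d) n ≠ 0) (hR : ∀ l ∈ (R f m b).roots, poch l n ≠ 0) :
    poch e n / poch (e - d) n *
        hyp ({-(n : ℂ), b, d} + params (fun i => f i + (m i : ℂ))) ({b + (M : ℂ), e} + params f) 1 =
      poch b M / pochVec f m + (1 - poch b M / pochVec f m) *
        hyp ({-(n : ℂ), 1, d} + (R f m b).roots.map (fun l => l + 1))
          ({b + (M : ℂ), 1 - e + d - (n : ℂ)} + (R f m b).roots) 1 := by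
  obtain ⟨N, rfl⟩ := Nat.exists_eq_add_of_le' hM1
  have hP : pochVec f m ≠ 0 := Finset.prod_ne_zero_iff.mpr fun i _ => (hf i).2
  have hfac := fun n : ℕ => (Nat.cast_ne_zero.mpr n.factorial_ne_zero : (n ! : ℂ) ≠ 0)
  set g : ℕ → ℂ := fun k => poch b k / poch (b + (N + 1 : ℕ)) k *
    ((sigmaPoly f m).eval (k : ℂ) / pochVec f m) with hg
  set ρ : ℂ := poch b (N + 1) / pochVec f m with hρ
  have hR0 := R_eval_zero f m hM hP b
  have hleft : ∀ p ∈ antidiagonal n, poch e n *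
      hypTerm ({-(n : ℂ), b, d} + params (fun i => f i + (m i : ℂ)))
        ({b + ((N + 1 : ℕ) : ℂ), e} + params f) 1 p.1 =
      (n.choose p.1 : ℂ) * ((-1) ^ p.1 * g p.1 * poch d p.1 * poch (e + p.1) p.2) := by
    intro p hp
    have hp' := mem_antidiagonal.mp hp
    have hple : p.1 ≤ n := by omega
    have h1 := poch_neg_nat_div_factorial p.1 p.2
    rw [hypTerm_params f m _ _ _ (fun i => poch_ne_zero_of_le (hf i).1 hple) hP,
      hypTerm_three_two]
    rw [hp'] at h1
    have h2 : poch e n = poch e p.1 * poch (e + p.1) p.2 := by rw [← poch_add, hp']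
    have h3 := poch_ne_zero_of_le he hple
    have h4 := poch_ne_zero hb p.1
    rw [show (n.choose p.1 : ℂ) * ((-1) ^ p.1 * g p.1 * poch d p.1 * poch (e + p.1) p.2) =
      ((-1) ^ p.1 * n.choose p.1) * (g p.1 * poch d p.1 * poch (e + p.1) p.2) by ring, ← h1, h2, hg]
    have := hfac p.1
    field_simp
  have hright : ∀ p ∈ antidiagonal n, poch (e - d) n * ((1 - ρ) *
      hypTerm ({-(n : ℂ), 1, d} + (R f m b).roots.map (fun l => l + 1))
          ({b + ((N + 1 : ℕ) : ℂ), 1 - e + d - (n : ℂ)} + (R f m b).roots) 1 p.1) =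
      (n.choose p.1 : ℂ) * (poch d p.1 * poch (e - d) p.2 * ((p.1 ! : ℂ) *
        (R f m b).eval (-(p.1 : ℂ)) / ((N ! : ℂ) * poch (b + (N + 1 : ℕ)) p.1))) := by
    intro p hp
    have hp' := mem_antidiagonal.mp hp
    have hple : p.1 ≤ n := by omega
    have h1 := poch_neg_nat_div_factorial p.1 p.2
    -- Reversal turns the lower parameter `1 - e + d - n` into the tail of `(e - d)_n`, leaving `(e
    -- - d)_{n-k}`.
    have h2 := poch_reflect (e - d + p.2) p.1
    have h3 : poch (e - d) n = poch (e - d) p.2 * poch (e - d + p.2) p.1 := by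
      rw [← poch_add, add_comm, hp']
    have h4 := poch_ne_zero hb p.1
    have h5 : poch (e - d + p.2) p.1 ≠ 0 := right_ne_zero_of_mul (h3 ▸ hed)
    have h6 := prod_poch_roots (R f m b) 0 p.1
    have h7 : ((R f m b).roots.map fun l => poch l p.1).prod ≠ 0 := by
      refine Multiset.prod_ne_zero fun h => ?_
      obtain ⟨l, hl, hl0⟩ := Multiset.mem_map.mp h
      exact poch_ne_zero_of_le (hR l hl) hple hl0
    have h8 := hfac p.1
    have h9 := hfac N
    rw [hp'] at h1
    rw [show 1 - (e - d + p.2) - (p.1 : ℂ) = 1 - e + d - n by rw [← hp']; push_cast; ring] at h2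
    simp only [zero_add, add_zero, neg_zero, zero_sub, hR0] at h6
    rw [hypTerm_add, Multiset.map_map, hypTerm_three_two, poch_one_left, h2, h3]
    simp only [Function.comp_def]
    have h10 : poch (-(n : ℂ)) p.1 = (-1) ^ p.1 * (n.choose p.1) * (p.1 ! : ℂ) := by
      rw [← h1, div_mul_cancel₀ _ h8]
    -- Obtained by cross-multiplication, so `R(0)` may vanish; for `R = 0` both `1 - ρ` and the
    -- right-hand side are zero.
    have h11 : (1 - ρ) * (((R f m b).roots.map fun l => poch (l + 1) p.1).prod /
        ((R f m b).roots.map fun l => poch l p.1).prod) =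
        (R f m b).eval (-(p.1 : ℂ)) / (N ! : ℂ) := by
      rw [← mul_div_assoc, div_eq_div_iff h7 h9]
      linear_combination h6
    have h12 : ((-1 : ℂ) ^ p.1) ≠ 0 := pow_ne_zero _ (by norm_num)
    rw [mul_left_comm (1 - ρ), h11, h10]
    field_simp
  rw [div_mul_eq_mul_div, div_eq_iff hed, hyp_eq_sum_of_neg_nat (n := n) (by simp),
    hyp_eq_sum_of_neg_nat (n := n) (by simp), Finset.mul_sum, Finset.sum_congr rfl hleft,
    add_mul, mul_comm _ (poch (e - d) n), mul_comm _ (poch (e - d) n), Finset.mul_sum,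
    Finset.mul_sum, Finset.sum_congr rfl hright, sum_choose_expand]
  -- The `if` is the defect at `l = 0` between the true value `1` and `R(0) / N! = 1 - ρ`.
  have hsum : ∀ l : ℕ, ∑ y ∈ antidiagonal l, (l.choose y.1 : ℂ) * ((-1) ^ y.1 * g y.1) =
      (if l = 0 then ρ else 0) +
      (l ! : ℂ) * (R f m b).eval (-(l : ℂ)) / ((N ! : ℂ) * poch (b + (N + 1 : ℕ)) l) := by
    intro l
    rcases Nat.eq_zero_or_pos l with rfl | hl
    · have := hfac N
      simp [hg, sigmaPoly_eval_zero, hP, hR0, ← hρ]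
      field_simp
      ring
    · rw [if_neg (by omega), zero_add, ← sum_choose_sigmaPoly f m hM hP b hl]
      have h4 := poch_ne_zero hb l
      have := hfac N
      rw [mul_comm (N ! : ℂ), mul_div_mul_right _ _ this, eq_div_iff h4, Finset.sum_mul]
      refine Finset.sum_congr rfl fun y hy => ?_
      have h5 : poch (b + (N + 1 : ℕ)) l = poch (b + (N + 1 : ℕ)) y.1 *
          poch (b + (N + 1 : ℕ) + y.1) y.2 := by rw [← poch_add, mem_antidiagonal.mp hy]
      have h6 := poch_ne_zero hb y.1
      rw [h5, hg]
      field_simp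
  simp only [hsum, mul_add, Finset.sum_add_distrib]
  congr 1
  rw [Finset.sum_eq_single (0, n)]
  · simp
  · rintro ⟨l, t⟩ h hne
    have : l ≠ 0 := by
      rintro rfl
      exact hne (by simpa using mem_antidiagonal.mp h)
    simp [this]
  · simp

end Terminating

/-! ### Values of `R̂` at negative integers, through Sheppard's transformation. -/

section RhatPolynomial

/-- At `t = -i - s` the parameter `t + s` becomes `-i`, so the series also stops at `i`, in the
shape of the right side of `sheppard`. Nonvanishing is needed only up to `N`: later terms carry
`(-N)_p = 0`. -/
lemma poly3F2_eval_neg (N i : ℕ) (s u v w : ℂ) (hv : ∀ p, p ≤ N → poch v p ≠ 0)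
    (hw : ∀ p, p ≤ N → poch w p ≠ 0) :
    poch v i * poch w i * (poly3F2 N s u v w).eval (-(i : ℂ) - s) =
      ∑ x ∈ antidiagonal i, (i.choose x.1 : ℂ) * ((-1) ^ x.1 * poch u x.1 *
        poch (-(N : ℂ)) x.1 * poch (w + x.1) x.2 * poch (v + x.1) x.2) := by
  have he : (poly3F2 N s u v w).eval (-(i : ℂ) - s) = ∑ x ∈ antidiagonal i,
      poch (-(N : ℂ)) x.1 * poch u x.1 / (poch v x.1 * poch w x.1 * (x.1 ! : ℂ)) *
        poch (-(i : ℂ)) x.1 := by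
    rw [Finset.Nat.sum_antidiagonal_eq_sum_range_succ (fun p _ => poch (-(N : ℂ)) p * poch u p /
      (poch v p * poch w p * (p ! : ℂ)) * poch (-(i : ℂ)) p)]
    have : (poly3F2 N s u v w).eval (-(i : ℂ) - s) = ∑ p ∈ range (N + 1),
        poch (-(N : ℂ)) p * poch u p / (poch v p * poch w p * (p ! : ℂ)) *
          poch (-(i : ℂ)) p := by
      simp [poly3F2, eval_finsetSum, poch]
    rw [this]
    rcases le_total N i with h | h
    · refine Finset.sum_subset (by simpa using h) fun p _ hp => ?_
      rw [poch_neg_nat_eq_zero (n := N) (by simpa using hp)]; simp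
    · refine (Finset.sum_subset (by simpa using h) fun p _ hp => ?_).symm
      rw [poch_neg_nat_eq_zero (n := i) (by simpa using hp)]; simp
  rw [he, Finset.mul_sum]
  refine Finset.sum_congr rfl fun x hx => ?_
  have hx' := HasAntidiagonal.mem_antidiagonal.mp hx
  rcases lt_or_ge N x.1 with h | h
  · rw [poch_neg_nat_eq_zero h]; simp
  · have h1 := poch_neg_nat_div_factorial x.1 x.2
    have h2 := hv _ h
    have h3 := hw _ h
    have h4 : (x.1 ! : ℂ) ≠ 0 := Nat.cast_ne_zero.mpr x.1.factorial_ne_zero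
    have h5 : poch v i = poch v x.1 * poch (v + x.1) x.2 := by rw [← poch_add, hx']
    have h6 : poch w i = poch w x.1 * poch (w + x.1) x.2 := by rw [← poch_add, hx']
    rw [hx', div_eq_iff h4] at h1
    rw [h1, h5, h6]
    field_simp

lemma poch_natCast_succ_mul (j i : ℕ) : poch ((j + 1 : ℕ) : ℂ) i * (j ! : ℂ) = ((j + i)! : ℂ) := by
  rw [← poch_one_left, ← poch_one_left, poch_add, Nat.cast_succ, add_comm (j : ℂ), mul_comm]

/-- After the shift by `j`, `sheppard` applies with `a + j`, `b + j`, `c + j` and `s = -b`; then `B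
+ s = j`, which becomes the integer lower parameter in `R̂`. -/
lemma sum_choose_descFactorial_euler (a b c : ℂ) (i j : ℕ) :
    ∑ p ∈ antidiagonal (j + i), ((j + i).choose p.1 : ℂ) * (p.1.descFactorial j *
        (poch (-b) p.2 * poch a p.1 * poch b p.1 * poch (c + p.1) p.2)) =
      (j + i).descFactorial j * (poch a j * poch b j) *
        ∑ x ∈ antidiagonal i, (i.choose x.1 : ℂ) * ((-1) ^ x.1 * poch (-b) x.1 *
          poch (a - c + j) x.1 * poch (a - b + j + x.1) x.2 * poch (j + x.1) x.2) := by
  have hs := sheppard (a + j) (b + j) (c + j) (-b) i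
  rw [show a + j + (b + j) + -b - (c + j) = a - c + j by ring,
    show a + j + -b = a - b + j by ring, show b + j + -b = (j : ℂ) by ring] at hs
  rw [sum_choose_mul_descFactorial i j
    (fun k q => poch (-b) q * poch a k * poch b k * poch (c + k) q), mul_assoc, ← hs]
  rw [Finset.mul_sum _ _ (poch a j * poch b j)]
  refine congrArg _ (Finset.sum_congr rfl fun x _ => ?_)
  rw [poch_add a, poch_add b, Nat.cast_add j, ← add_assoc c]
  ring

/-- For `j = 0` the lower parameter is `0`: the leading term drops out and the index shifts by one.
This raises the parameters and explains the exceptional first summand of `R̂`. -/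
lemma euler_descFactorial_zero (a b : ℂ) (N l : ℕ) (hab : ∀ j : ℕ, j < N + 1 → a - b ≠ -(j : ℂ)) :
    ∑ p ∈ antidiagonal (l + 1), ((l + 1).choose p.1 : ℂ) *
        (poch (-b) p.2 * poch a p.1 * poch b p.1 * poch (a + (N + 1 : ℕ) + p.1) p.2) =
      -((l + 1)! : ℂ) * poch (a - b) (l + 1) * ((-((N + 1 : ℕ) : ℂ)) * (-b) / (a - b) *
        (poly3F2 N 1 (1 - b) 2 (a - b + 1)).eval (-((l + 1 : ℕ) : ℂ))) := by
  have h0 : a - b ≠ 0 := by simpa using hab 0 (by omega)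
  have hE := sum_choose_descFactorial_euler a b (a + (N + 1 : ℕ)) (l + 1) 0
  have hpoly := poly3F2_eval_neg N l 1 (1 - b) 2 (a - b + 1)
    (fun p _ => poch_ne_zero (by
      rintro ⟨q, hq⟩
      have : (2 : ℂ) + q = 0 := by rw [hq]; ring
      exact absurd this (by exact_mod_cast (by omega : 2 + q ≠ 0))) p)
    (fun p hp => fun h => by
      obtain ⟨q, hq, h⟩ := (poch_eq_zero_iff _ _).mp h
      exact hab (q + 1) (by omega) (by push_cast; linear_combination h))
  have h2 : poch 2 l = ((l + 1)! : ℂ) := by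
    have := poch_natCast_succ_mul 1 l
    norm_num at this
    rw [this, add_comm]
  simp only [zero_add, Nat.descFactorial_zero, Nat.cast_one, one_mul, poch_zero, Nat.cast_zero,
    add_zero] at hE
  rw [hE]
  rw [show -(l : ℂ) - 1 = -((l + 1 : ℕ) : ℂ) by push_cast; ring, h2] at hpoly
  rw [Finset.Nat.sum_antidiagonal_succ]
  simp only [Nat.cast_zero, zero_add, poch_zero_left (Nat.succ_ne_zero l), mul_zero]
  have hrhs : -((l + 1)! : ℂ) * poch (a - b) (l + 1) * ((-((N + 1 : ℕ) : ℂ)) * (-b) / (a - b) *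
        (poly3F2 N 1 (1 - b) 2 (a - b + 1)).eval (-((l + 1 : ℕ) : ℂ))) =
      -((N + 1 : ℕ) * b) * (((l + 1)! : ℂ) * poch (a - b + 1) l *
        (poly3F2 N 1 (1 - b) 2 (a - b + 1)).eval (-((l + 1 : ℕ) : ℂ))) := by
    rw [poch_succ_left]; field_simp
  rw [hrhs, hpoly, Finset.mul_sum]
  refine Finset.sum_congr rfl fun x hx => ?_
  have hx' := HasAntidiagonal.mem_antidiagonal.mp hx
  have hc : ((l + 1 : ℕ) : ℂ) * l.choose x.1 = (l + 1).choose (x.1 + 1) * (x.1 + 1 : ℕ) := by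
    exact_mod_cast Nat.add_one_mul_choose_eq l x.1
  have hp : ((x.1 : ℂ) + 1) * poch (2 + x.1) x.2 = poch (1 + x.1) x.2 * (l + 1) := by
    have := (poch_succ_left (1 + x.1 : ℂ) x.2).symm.trans (poch_succ (1 + x.1 : ℂ) x.2)
    rw [show (1 : ℂ) + x.1 + 1 = 2 + x.1 by ring] at this
    rw [← hx']; push_cast
    linear_combination this
  have hpc : ((l + 1).choose (x.1 + 1) : ℂ) * poch (1 + x.1) x.2 =
      l.choose x.1 * poch (2 + x.1) x.2 := by
    have h3 : ((x.1 : ℂ) + 1) ≠ 0 := by exact_mod_cast Nat.succ_ne_zero x.1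
    apply mul_left_cancel₀ h3
    push_cast at hc
    linear_combination (-(poch (1 + x.1) x.2)) * hc - (l.choose x.1 : ℂ) * hp
  rw [poch_succ_left (-b), show a - (a + (N + 1 : ℕ)) = -((N + 1 : ℕ) : ℂ) by ring,
    poch_succ_left (-((N + 1 : ℕ) : ℂ)), show -((N + 1 : ℕ) : ℂ) + 1 = -N by push_cast; ring,
    show -b + 1 = 1 - b by ring, pow_succ]
  push_cast
  rw [add_comm (x.1 : ℂ) 1, ← add_assoc (a - b)]
  linear_combination ((-1) ^ x.1 * (-1) * (-b) * poch (1 - b) x.1 * (-(N + 1 : ℂ)) *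
    poch (-(N : ℂ)) x.1 * poch (a - b + 1 + x.1) x.2) * hpc

/-- For `l ≤ j` both sides vanish, the right one through `(1 - l)_j`; otherwise the shifted Sheppard
sum is the evaluation of the `₃F₂` at `-l`. -/
lemma euler_descFactorial_succ (a b : ℂ) {M l j : ℕ} (hl : 1 ≤ l) (hj : j + 1 ≤ M)
    (hab : ∀ j : ℕ, j < M → a - b ≠ -(j : ℂ)) :
    ∑ p ∈ antidiagonal l, (l.choose p.1 : ℂ) * (p.1.descFactorial (j + 1) *
        (poch (-b) p.2 * poch a p.1 * poch b p.1 * poch (a + M + p.1) p.2)) =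
      -(l ! : ℂ) * poch (a - b) l * ((-1) ^ (j + 1) * poch a (j + 1) * poch b (j + 1) /
        (poch 1 j * poch (a - b) (j + 1)) * poch (-(l : ℂ) + 1) j *
        (poly3F2 (M - (j + 1)) (j + 1 : ℕ) (-b) (j + 1 : ℕ) (a - b + (j + 1 : ℕ))).eval
          (-(l : ℂ))) := by
  rcases lt_or_ge l (j + 1) with h | h
  · rw [sum_choose_mul_descFactorial_of_lt h
      (fun k q => poch (-b) q * poch a k * poch b k * poch (a + M + k) q)]
    rw [show -(l : ℂ) + 1 = -((l - 1 : ℕ) : ℂ) by rw [Nat.cast_sub hl]; push_cast; ring,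
      poch_neg_nat_eq_zero (n := l - 1) (k := j) (by omega)]
    ring
  · obtain ⟨i, rfl⟩ := Nat.exists_eq_add_of_le h
    have hpoly := poly3F2_eval_neg (M - (j + 1)) i (j + 1 : ℕ) (-b) (j + 1 : ℕ)
      (a - b + (j + 1 : ℕ))
      (fun p _ => fun h => by
        obtain ⟨q, hq, h⟩ := (poch_eq_zero_iff _ _).mp h
        have : ((j + 1 : ℕ) : ℂ) + q = 0 := by rw [h]; ring
        exact absurd this (by exact_mod_cast (by omega : j + 1 + q ≠ 0)))
      (fun p hp => fun h => by
        obtain ⟨q, hq, h⟩ := (poch_eq_zero_iff _ _).mp h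
        exact hab (q + (j + 1)) (by omega) (by rw [Nat.cast_add q]; linear_combination h))
    have h0 : poch (a - b) (j + 1) ≠ 0 := fun h => by
      obtain ⟨q, hq, h⟩ := (poch_eq_zero_iff _ _).mp h
      exact hab q (by omega) h
    have hfac := fun n : ℕ => (Nat.cast_ne_zero.mpr n.factorial_ne_zero : (n ! : ℂ) ≠ 0)
    have h1 := poch_neg_nat_mul j i
    have h2 := poch_natCast_succ_mul j i
    have h3 : (i ! : ℂ) * (j + 1 + i).descFactorial (j + 1) = (j + 1 + i)! := by
      exact_mod_cast (by simpa using Nat.factorial_mul_descFactorial (Nat.le_add_right (j + 1) i))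
    have hj0 := hfac j
    have hi0 := hfac i
    have h4 : ((j + 1 + i).descFactorial (j + 1) : ℂ) * poch ((j + 1 : ℕ) : ℂ) i * (j ! : ℂ) =
        -((j + 1 + i)! : ℂ) * ((-1) ^ (j + 1) * poch (-((j + i : ℕ) : ℂ)) j) := by
      apply mul_left_cancel₀ hi0
      have : ((-1 : ℂ) ^ j) * (-1) ^ j = 1 := by rw [← mul_pow]; simp
      rw [pow_succ]
      linear_combination (poch ((j + 1 : ℕ) : ℂ) i * (j ! : ℂ)) * h3 + ((j + 1 + i)! : ℂ) * h2 -
        ((j + 1 + i)! : ℂ) * (-1) ^ j * h1 - ((j + 1 + i)! : ℂ) * ((j + i)! : ℂ) * this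
    rw [sum_choose_descFactorial_euler,
      show a - (a + M) + (j + 1 : ℕ) = -((M - (j + 1) : ℕ) : ℂ) by rw [Nat.cast_sub hj]; ring,
      ← hpoly, show -(i : ℂ) - (j + 1 : ℕ) = -((j + 1 + i : ℕ) : ℂ) by push_cast; ring,
      show -((j + 1 + i : ℕ) : ℂ) + 1 = -((j + i : ℕ) : ℂ) by push_cast; ring, poch_one_left,
      poch_add (a - b)]
    generalize (poly3F2 (M - (j + 1)) (j + 1 : ℕ) (-b) (j + 1 : ℕ) (a - b + (j + 1 : ℕ))).eval
      (-((j + 1 + i : ℕ) : ℂ)) = S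
    generalize poch (a - b + (j + 1 : ℕ)) i = W
    field_simp
    linear_combination (poch a (j + 1) * poch b (j + 1) * W * S) * h4

variable {r : ℕ} (f : Fin r → ℂ) (m : Fin r → ℕ)

lemma Rhat_eval {N : ℕ} (hN : ∑ i, m i = N + 1) (a b t : ℂ) :
    (Rhat f m a b).eval t =
      (∑ j ∈ range (N + 1), Ccoeff f m (j + 1) * ((-1) ^ (j + 1) * poch a (j + 1) *
        poch b (j + 1) / (poch 1 j * poch (a - b) (j + 1)) * poch (t + 1) j *
        (poly3F2 (N + 1 - (j + 1)) (j + 1 : ℕ) (-b) (j + 1 : ℕ) (a - b + (j + 1 : ℕ))).eval t)) +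
      Ccoeff f m 0 * ((-((N + 1 : ℕ) : ℂ)) * (-b) / (a - b) *
        (poly3F2 N 1 (1 - b) 2 (a - b + 1)).eval t) := by
  have key := Finset.sum_Ico_add' (fun j => Ccoeff f m j * ((-1) ^ j * poch a j *
    poch b j / (poch 1 (j - 1) * poch (a - b) j) * poch (t + 1) (j - 1) *
    (poly3F2 (N + 1 - j) j (-b) j (a - b + j)).eval t)) 0 (N + 1) 1
  simp only [Nat.add_sub_cancel] at key
  rw [Rhat, hN, eval_add, add_comm, eval_finsetSum, Finset.range_eq_Ico, key]
  congr 1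
  · refine Finset.sum_congr (by ext; simp) fun j _ => ?_
    simp [poch]; ring
  · simp; ring

/-- The Taylor coefficients of `(1 - z) ^ b` times the generating function of
`(a)_k (b)_k P(k) / ((c)_k k!)`, where `P = sigmaPoly f m` and `c = a + ∑ i, m i`. -/
lemma sum_euler_sigmaPoly {M : ℕ} (hM : ∑ i, m i = M) (hM1 : 1 ≤ M) (h : pochVec f m ≠ 0)
    {a b : ℂ} (ha : ¬ IsNonposInt (a + M)) (hab : ∀ j : ℕ, j < M → a - b ≠ -(j : ℂ)) {l : ℕ}
    (hl : 1 ≤ l) :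
    ∑ p ∈ antidiagonal l, poch a p.1 * poch b p.1 / (poch (a + M) p.1 * (p.1 ! : ℂ)) *
        ((sigmaPoly f m).eval (p.1 : ℂ) / pochVec f m) * (poch (-b) p.2 / (p.2 ! : ℂ)) =
      -poch (a - b) l / poch (a + M) l * (Rhat f m a b).eval (-(l : ℂ)) := by
  obtain ⟨N, rfl⟩ := Nat.exists_eq_add_of_le' hM1
  have hfac := fun n : ℕ => (Nat.cast_ne_zero.mpr n.factorial_ne_zero : (n ! : ℂ) ≠ 0)
  have hP : ∀ k : ℕ, (sigmaPoly f m).eval (k : ℂ) / pochVec f m =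
      ∑ j ∈ range (N + 1 + 1), Ccoeff f m j * k.descFactorial j := by
    intro k
    rw [sigmaPoly_eval_natCast f m h, mul_div_cancel_left₀ _ h, hM]
  have hl0 := hfac l
  have hal := poch_ne_zero ha l
  have hterm : ∀ p ∈ antidiagonal l,
      poch a p.1 * poch b p.1 / (poch (a + (N + 1 : ℕ)) p.1 * (p.1 ! : ℂ)) *
        ((sigmaPoly f m).eval (p.1 : ℂ) / pochVec f m) * (poch (-b) p.2 / (p.2 ! : ℂ)) =
      1 / ((l ! : ℂ) * poch (a + (N + 1 : ℕ)) l) * ∑ j ∈ range (N + 1 + 1), Ccoeff f m j *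
        ((l.choose p.1 : ℂ) * (p.1.descFactorial j *
        (poch (-b) p.2 * poch a p.1 * poch b p.1 * poch (a + (N + 1 : ℕ) + p.1) p.2))) := by
    intro p hp
    have hp' := HasAntidiagonal.mem_antidiagonal.mp hp
    have h1 : poch (a + (N + 1 : ℕ)) l = poch (a + (N + 1 : ℕ)) p.1 *
        poch (a + (N + 1 : ℕ) + p.1) p.2 := by rw [← poch_add, hp']
    have h2 : (l.choose p.1 : ℂ) = (l ! : ℂ) / ((p.1 ! : ℂ) * (p.2 ! : ℂ)) := by
      rw [← hp', Nat.cast_add_choose]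
    have h3 : ∑ j ∈ range (N + 1 + 1), Ccoeff f m j * ((l.choose p.1 : ℂ) *
        (p.1.descFactorial j * (poch (-b) p.2 * poch a p.1 * poch b p.1 *
          poch (a + (N + 1 : ℕ) + p.1) p.2))) =
        ((sigmaPoly f m).eval (p.1 : ℂ) / pochVec f m) * ((l.choose p.1 : ℂ) *
          (poch (-b) p.2 * poch a p.1 * poch b p.1 * poch (a + (N + 1 : ℕ) + p.1) p.2)) := by
      rw [hP, Finset.sum_mul]
      exact Finset.sum_congr rfl fun j _ => by ring
    have h4 := poch_ne_zero ha p.1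
    have h5 : poch (a + (N + 1 : ℕ) + p.1) p.2 ≠ 0 := right_ne_zero_of_mul (h1 ▸ hal)
    have h6 := hfac p.1
    have h7 := hfac p.2
    rw [h3, h2, h1]
    generalize (sigmaPoly f m).eval (p.1 : ℂ) / pochVec f m = S
    field_simp
  rw [Finset.sum_congr rfl hterm, ← Finset.mul_sum, Finset.sum_comm, Finset.sum_range_succ',
    Rhat_eval f m hM]
  simp only [← Finset.mul_sum]
  obtain ⟨l, rfl⟩ := Nat.exists_eq_add_of_le' hl
  have hz := euler_descFactorial_zero a b N l hab
  simp only [Nat.descFactorial_zero, Nat.cast_one, one_mul]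
  rw [hz, Finset.sum_congr rfl fun j hj => by
    rw [euler_descFactorial_succ a b hl (Finset.mem_range.mp hj) hab]]
  simp only [mul_left_comm (Ccoeff f m _) (-((l + 1)! : ℂ) * poch (a - b) (l + 1))]
  rw [← Finset.mul_sum, ← mul_add]
  field_simp

/-- Compare the formula for `c_1` with its two-term definition `-b + a b P(1) / ((a + M) P(0))`. -/
lemma Rhat_eval_neg_one {M : ℕ} (hM : ∑ i, m i = M) (hM1 : 1 ≤ M) (h : pochVec f m ≠ 0)
    {a b : ℂ} (ha : ¬ IsNonposInt (a + M)) (hab : ∀ j : ℕ, j < M → a - b ≠ -(j : ℂ))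
    (hf : ∀ i, f i ≠ 0) :
    (a - b) * (Rhat f m a b).eval (-1) =
      -b * (a + M) * (a * (∏ i, (f i + (m i : ℂ))) / ((a + (M : ℂ)) * ∏ i, f i) - 1) := by
  have h1 := sum_euler_sigmaPoly f m hM hM1 h ha hab le_rfl
  have h2 := prod_poch_params f m 1
  have ha0 := poch_ne_zero ha 1
  have hf0 : ∏ i, f i ≠ 0 := Finset.prod_ne_zero_iff.mpr fun i _ => hf i
  simp only [poch_one, Nat.cast_one] at h2 ha0
  rw [Finset.Nat.sum_antidiagonal_succ] at h1
  simp [sigmaPoly_eval_zero, h] at h1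
  have h3 : (sigmaPoly f m).eval 1 / pochVec f m =
      (∏ i, (f i + (m i : ℂ))) / ∏ i, f i := by
    rw [div_eq_div_iff h hf0]; linear_combination -h2
  rw [h3] at h1
  field_simp at h1 ⊢
  linear_combination h1

end RhatPolynomial

/-! ### Power-law bounds for quotients of rising factorials. -/

section Growth

lemma poch_eq_prod (x : ℂ) (k : ℕ) : poch x k = ∏ j ∈ range k, (x + j) := by
  induction k with
  | zero => simp
  | succ k ih => rw [poch_succ, ih, Finset.prod_range_succ]

lemma GammaSeq_eq (s : ℂ) (n : ℕ) :
    Complex.GammaSeq s n = (n : ℂ) ^ s * n ! / poch s (n + 1) := by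
  rw [Complex.GammaSeq, poch_eq_prod]

lemma Gamma_ne_zero {x : ℂ} (hx : ¬ IsNonposInt x) : Complex.Gamma x ≠ 0 :=
  Complex.Gamma_ne_zero fun N h => hx ⟨N, h⟩

lemma Gamma_add_nat {x : ℂ} (hx : ¬ IsNonposInt x) (l : ℕ) :
    Complex.Gamma (x + l) = poch x l * Complex.Gamma x := by
  induction l with
  | zero => simp
  | succ l ih =>
    rw [Nat.cast_succ, ← add_assoc, Complex.Gamma_add_one, ih, poch_succ]
    · ring
    · exact fun h => hx ⟨l, by linear_combination h⟩

/-- Euler's limit for the Gamma function makes `(a)_k / (b)_k` asymptotic to `Γ(b) / Γ(a) ·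
k^{a-b}`. When `a ∈ -ℕ₀` the quotient is eventually zero. -/
lemma norm_poch_div_poch_le (a : ℂ) {b : ℂ} (hb : ¬ IsNonposInt b) :
    ∃ K : ℝ, 0 ≤ K ∧ ∀ k : ℕ, ‖poch a k / poch b k‖ ≤ K * ((k : ℝ) + 1) ^ (a.re - b.re) := by
  have hpos : ∀ k : ℕ, 0 < ((k : ℝ) + 1) ^ (a.re - b.re) := fun k => by positivity
  suffices h : ∃ L, Tendsto (fun k : ℕ => ‖poch a k / poch b k‖ / ((k : ℝ) + 1) ^ (a.re - b.re))
      atTop (𝓝 L) by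
    obtain ⟨L, hL⟩ := h
    obtain ⟨K, hK⟩ := hL.bddAbove_range
    refine ⟨max K 0, le_max_right _ _, fun k => ?_⟩
    rw [← div_le_iff₀ (hpos k)]
    exact (hK ⟨k, rfl⟩).trans (le_max_left _ _)
  by_cases ha : IsNonposInt a
  · obtain ⟨N, rfl⟩ := ha
    refine ⟨0, tendsto_const_nhds.congr' ?_⟩
    filter_upwards [eventually_gt_atTop N] with k hk
    rw [poch_neg_nat_eq_zero hk]; simp
  · refine ⟨‖Complex.Gamma b / Complex.Gamma a‖ * 1 ^ (a.re - b.re), ?_⟩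
    rw [← tendsto_add_atTop_iff_nat 1]
    have h1 := ((Complex.GammaSeq_tendsto_Gamma b).div (Complex.GammaSeq_tendsto_Gamma a)
      (Gamma_ne_zero ha)).norm
    have h2 : Tendsto (fun n : ℕ => (n : ℝ) / (n + 2)) atTop (𝓝 1) :=
      tendsto_natCast_div_add_atTop 2
    refine (h1.mul (h2.rpow_const (p := a.re - b.re) (Or.inl one_ne_zero))).congr' ?_
    filter_upwards [eventually_gt_atTop 0] with n hn
    have hn' : (0 : ℝ) < n := by exact_mod_cast hn
    have h3 := poch_ne_zero ha (n + 1)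
    have h4 := poch_ne_zero hb (n + 1)
    have h5 : (n ! : ℂ) ≠ 0 := Nat.cast_ne_zero.mpr n.factorial_ne_zero
    have h6 : ((n : ℂ) ^ a) ≠ 0 := by
      rw [Complex.cpow_ne_zero_iff]; left; exact_mod_cast hn.ne'
    have h7 : Complex.GammaSeq b n / Complex.GammaSeq a n =
        (n : ℂ) ^ b / (n : ℂ) ^ a * (poch a (n + 1) / poch b (n + 1)) := by
      rw [GammaSeq_eq, GammaSeq_eq]; field_simp
    rw [Pi.div_apply, h7, norm_mul, norm_div, Complex.norm_natCast_cpow_of_pos hn,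
      Complex.norm_natCast_cpow_of_pos hn, Real.div_rpow hn'.le (by positivity),
      Real.rpow_sub hn']
    push_cast
    rw [show (n : ℝ) + 1 + 1 = n + 2 by ring]
    have h8 : (0 : ℝ) < (n : ℝ) ^ a.re := by positivity
    have h9 : (0 : ℝ) < (n : ℝ) ^ b.re := by positivity
    field_simp

lemma norm_poch_div_factorial_le (a : ℂ) :
    ∃ K : ℝ, 0 ≤ K ∧ ∀ k : ℕ, ‖poch a k / (k ! : ℂ)‖ ≤ K * ((k : ℝ) + 1) ^ (a.re - 1) := by
  have h1 : ¬ IsNonposInt 1 := fun ⟨N, hN⟩ => by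
    have : (1 : ℂ) + N = 0 := by rw [hN]; ring
    exact absurd this (by exact_mod_cast (by omega : 1 + N ≠ 0))
  simpa [poch_one_left] using norm_poch_div_poch_le a h1

lemma summable_nat_add_one_rpow {p : ℝ} (hp : p < -1) :
    Summable fun k : ℕ => ((k : ℝ) + 1) ^ p := by
  have := (summable_nat_add_iff 1).mpr (Real.summable_nat_rpow.mpr hp)
  simpa using this

lemma norm_eval_natCast_le (Q : ℂ[X]) {D : ℕ} (hQ : Q.natDegree ≤ D) (c : ℂ) :
    ∃ K : ℝ, 0 ≤ K ∧ ∀ k : ℕ, ‖Q.eval (c * k)‖ ≤ K * ((k : ℝ) + 1) ^ (D : ℝ) := by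
  refine ⟨∑ i ∈ range (Q.natDegree + 1), ‖Q.coeff i‖ * ‖c‖ ^ i, by positivity, fun k => ?_⟩
  rw [eval_eq_sum_range, Finset.sum_mul, Real.rpow_natCast]
  refine (norm_sum_le _ _).trans (Finset.sum_le_sum fun i hi => ?_)
  have hi' : i ≤ D := (Nat.lt_succ_iff.mp (Finset.mem_range.mp hi)).trans hQ
  rw [norm_mul, norm_pow, norm_mul, mul_pow, Complex.norm_natCast, mul_assoc]
  refine mul_le_mul_of_nonneg_left (mul_le_mul_of_nonneg_left ?_ (by positivity)) (norm_nonneg _)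
  exact (pow_le_pow_left₀ (by positivity) (by linarith) i).trans
    (pow_le_pow_right₀ (by linarith [Nat.cast_nonneg (α := ℝ) k]) hi')

end Growth

/-! ### Gauss's summation theorem, including terminating series. -/

section Gauss

/-- The `k`-th term of Gauss's series `₂F₁(a, b; c; 1)`. -/
noncomputable def gaussTerm (a b c : ℂ) (k : ℕ) : ℂ :=
  poch a k * poch b k / (poch c k * (k ! : ℂ))

/-- The convergence condition of Gauss's series `₂F₁(a, b; c; 1)`. -/
def GaussConv (a b c : ℂ) : Prop :=
  0 < (c - a - b).re ∨ IsNonposInt a ∨ IsNonposInt b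

/-- A single estimate for convergent and terminating series, yielding both absolute summability and
`k t_k → 0`. -/
lemma gaussTerm_bound {a b c : ℂ} (hc : ¬ IsNonposInt c) (h : GaussConv a b c) :
    ∃ K δ : ℝ, 0 < δ ∧ ∀ k, ‖gaussTerm a b c k‖ ≤ K * ((k : ℝ) + 1) ^ (-1 - δ) := by
  have hfin : ∀ N : ℕ, (∀ k, N < k → gaussTerm a b c k = 0) →
      ∃ K δ : ℝ, 0 < δ ∧ ∀ k, ‖gaussTerm a b c k‖ ≤ K * ((k : ℝ) + 1) ^ (-1 - δ) := by
    intro N hN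
    refine ⟨∑ j ∈ range (N + 1), ‖gaussTerm a b c j‖ * ((j : ℝ) + 1) ^ (2 : ℝ), 1, one_pos,
      fun k => ?_⟩
    rcases lt_or_ge N k with h | h
    · rw [hN k h, norm_zero]; positivity
    · rw [show (-1 - 1 : ℝ) = -2 by norm_num, Real.rpow_neg (by positivity), ← div_eq_mul_inv,
        le_div_iff₀ (by positivity)]
      exact Finset.single_le_sum (f := fun j : ℕ => ‖gaussTerm a b c j‖ * ((j : ℝ) + 1) ^ (2 : ℝ))
        (fun j _ => by positivity) (by simpa using Nat.lt_succ_of_le h)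
  rcases h with h | ⟨N, rfl⟩ | ⟨N, rfl⟩
  · obtain ⟨K, hK, h1⟩ := norm_poch_div_poch_le a hc
    obtain ⟨K', hK', h2⟩ := norm_poch_div_factorial_le b
    refine ⟨K * K', (c - a - b).re, h, fun k => ?_⟩
    rw [gaussTerm, mul_div_mul_comm, norm_mul]
    refine (mul_le_mul (h1 k) (h2 k) (norm_nonneg _) (by positivity)).trans (le_of_eq ?_)
    rw [mul_mul_mul_comm, ← Real.rpow_add (by positivity)]
    congr 2
    simp; ring
  · exact hfin N fun k hk => by rw [gaussTerm, poch_neg_nat_eq_zero hk]; simp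
  · exact hfin N fun k hk => by rw [gaussTerm, poch_neg_nat_eq_zero hk]; simp

lemma gaussTerm_summable_norm {a b c : ℂ} (hc : ¬ IsNonposInt c) (h : GaussConv a b c) :
    Summable fun k => ‖gaussTerm a b c k‖ := by
  obtain ⟨K, δ, hδ, hK⟩ := gaussTerm_bound hc h
  exact Summable.of_nonneg_of_le (fun _ => norm_nonneg _) hK
    ((summable_nat_add_one_rpow (by linarith)).mul_left K)

lemma tendsto_nat_mul_gaussTerm {a b c : ℂ} (hc : ¬ IsNonposInt c) (h : GaussConv a b c) :
    Tendsto (fun k : ℕ => (k : ℂ) * gaussTerm a b c k) atTop (𝓝 0) := by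
  obtain ⟨K, δ, hδ, hK⟩ := gaussTerm_bound hc h
  have h1 : Tendsto (fun k : ℕ => K * ((k : ℝ) + 1) ^ (-δ)) atTop (𝓝 0) := by
    have := ((tendsto_rpow_neg_atTop hδ).comp
      (tendsto_atTop_add_const_right _ (1 : ℝ) tendsto_natCast_atTop_atTop)).const_mul K
    simpa using this
  refine squeeze_zero_norm (fun k => ?_) h1
  have hK0 : 0 ≤ K := by simpa using (norm_nonneg _).trans (hK 0)
  have hk : (0 : ℝ) < (k : ℝ) + 1 := by positivity
  rw [norm_mul, Complex.norm_natCast]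
  calc (k : ℝ) * ‖gaussTerm a b c k‖ ≤ (k + 1) * (K * ((k : ℝ) + 1) ^ (-1 - δ)) :=
        mul_le_mul (by linarith) (hK k) (norm_nonneg _) (by positivity)
    _ = K * ((k : ℝ) + 1) ^ (-δ) := by
        rw [show -δ = 1 + (-1 - δ) by ring, Real.rpow_add hk, Real.rpow_one]; ring

lemma not_isNonposInt_add_nat {x : ℂ} (h : ¬ IsNonposInt x) (n : ℕ) : ¬ IsNonposInt (x + n) :=
  fun h' => h h'.of_add_nat

lemma not_isNonposInt_add_one {x : ℂ} (h : ¬ IsNonposInt x) : ¬ IsNonposInt (x + 1) := by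
  simpa using not_isNonposInt_add_nat h 1

lemma GaussConv.add_one {a b c : ℂ} (h : GaussConv a b c) : GaussConv a b (c + 1) := by
  refine h.imp_left fun h => ?_
  simp only [Complex.sub_re, Complex.add_re, Complex.one_re] at h ⊢
  linarith

lemma GaussConv.add_nat {a b c : ℂ} (h : GaussConv a b c) (n : ℕ) : GaussConv a b (c + n) := by
  induction n with
  | zero => simpa
  | succ n ih => rw [Nat.cast_succ, ← add_assoc]; exact ih.add_one

/-- The difference of the two series telescopes: its `n`-th partial sum is `-c n t_n`, which tends
to `0`. -/
lemma gauss_contiguous {a b c : ℂ} (hc : ¬ IsNonposInt c) (h : GaussConv a b c) :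
    c * (c - a - b) * ∑' k, gaussTerm a b c k =
      (c - a) * (c - b) * ∑' k, gaussTerm a b (c + 1) k := by
  have h1 := (gaussTerm_summable_norm hc h).of_norm.hasSum.mul_left (c * (c - a - b))
  have h2 := (gaussTerm_summable_norm (not_isNonposInt_add_one hc)
    h.add_one).of_norm.hasSum.mul_left ((c - a) * (c - b))
  have h3 := (h1.sub h2).tendsto_sum_nat
  have h4 : ∀ n, ∑ k ∈ range n, (c * (c - a - b) * gaussTerm a b c k -
      (c - a) * (c - b) * gaussTerm a b (c + 1) k) = -c * (n * gaussTerm a b c n) := by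
    intro n
    induction n with
    | zero => simp
    | succ n ih =>
      have h5 := poch_ne_zero hc n
      have h6 : poch (c + 1) n ≠ 0 := poch_ne_zero (not_isNonposInt_add_one hc) n
      have h7 : c + n ≠ 0 := fun h => hc ⟨n, by linear_combination h⟩
      have h8 : c ≠ 0 := fun h => hc ⟨0, by simpa using h⟩
      have h9 : (n ! : ℂ) ≠ 0 := Nat.cast_ne_zero.mpr n.factorial_ne_zero
      have h10 : (n : ℂ) + 1 ≠ 0 := by exact_mod_cast Nat.succ_ne_zero n
      have h11 : poch (c + 1) n = poch c n * (c + n) / c := by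
        rw [eq_div_iff h8, ← poch_succ, poch_succ_left]; ring
      rw [Finset.sum_range_succ, ih]
      simp only [gaussTerm, poch_succ, h11, Nat.factorial_succ]
      push_cast
      field_simp
      ring
  simp only [h4] at h3
  have h5 := (tendsto_nat_mul_gaussTerm hc h).const_mul (-c)
  rw [mul_zero] at h5
  exact sub_eq_zero.mp (tendsto_nhds_unique h3 h5)

lemma gauss_shift {a b c : ℂ} (hc : ¬ IsNonposInt c) (hcab : ¬ IsNonposInt (c - a - b))
    (h : GaussConv a b c) (n : ℕ) :
    ∑' k, gaussTerm a b c k = poch (c - a) n * poch (c - b) n / (poch c n * poch (c - a - b) n) *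
      ∑' k, gaussTerm a b (c + n) k := by
  induction n with
  | zero => simp
  | succ n ih =>
    have h1 := gauss_contiguous (not_isNonposInt_add_nat hc n) (h.add_nat n)
    have h2 := poch_ne_zero hc n
    have h3 := poch_ne_zero hcab n
    have h4 : c + n ≠ 0 := fun h => hc ⟨n, by linear_combination h⟩
    have h5 : c - a - b + n ≠ 0 := fun h => hcab ⟨n, by linear_combination h⟩
    rw [ih, Nat.cast_succ, ← add_assoc, poch_succ, poch_succ, poch_succ, poch_succ]
    have h6 : ∑' k, gaussTerm a b (c + n) k = (c - a + n) * (c - b + n) /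
        ((c + n) * (c - a - b + n)) * ∑' k, gaussTerm a b (c + n + 1) k := by
      field_simp
      linear_combination h1
    rw [h6]
    field_simp

lemma norm_poch_le_of_re_le {x : ℝ} (hx : 0 < x) {z : ℂ} (hz : x ≤ z.re) (k : ℕ) :
    ‖poch (x : ℂ) k‖ ≤ ‖poch z k‖ := by
  rw [poch_eq_prod, poch_eq_prod, norm_prod, norm_prod]
  refine Finset.prod_le_prod (fun _ _ => norm_nonneg _) fun j _ => ?_
  rw [← Complex.ofReal_natCast, ← Complex.ofReal_add, Complex.norm_real, Real.norm_eq_abs,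
    abs_of_pos (by positivity)]
  refine le_trans ?_ (Complex.re_le_norm _)
  simpa using hz

/-- Every term but the zeroth tends to `0`. Once `Re (c + n) ≥ x = ‖a‖ + ‖b‖ + 1`, the terms are
dominated by the absolutely convergent series with lower parameter `x`. -/
lemma tendsto_tsum_gaussTerm (a b c : ℂ) :
    Tendsto (fun n : ℕ => ∑' k, gaussTerm a b (c + n) k) atTop (𝓝 1) := by
  set x : ℝ := ‖a‖ + ‖b‖ + 1 with hx
  have hx0 : 0 < x := by positivity
  have hxn : ¬ IsNonposInt (x : ℂ) := by
    rintro ⟨N, hN⟩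
    have : x = -(N : ℝ) := by exact_mod_cast hN
    linarith [Nat.cast_nonneg (α := ℝ) N]
  have hxc : GaussConv a b (x : ℂ) := by
    left
    have h1 := Complex.re_le_norm a
    have h2 := Complex.re_le_norm b
    simp only [Complex.sub_re, Complex.ofReal_re]
    linarith
  have hre : ∀ y : ℝ, ∀ᶠ n : ℕ in atTop, y ≤ (c + n).re := by
    intro y
    have := (tendsto_atTop_add_const_left _ c.re
      (tendsto_natCast_atTop_atTop (R := ℝ))).eventually_ge_atTop y
    simpa using this
  have hpx : ∀ k, 0 < ‖poch (x : ℂ) k‖ := fun k => norm_pos_iff.mpr (poch_ne_zero hxn k)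
  have hlim : Tendsto (fun n : ℕ => ∑' k, gaussTerm a b (c + n) k) atTop
      (𝓝 (∑' k : ℕ, if k = 0 then (1 : ℂ) else 0)) := by
    refine tendsto_tsum_of_dominated_convergence (gaussTerm_summable_norm hxn hxc) ?_ ?_
    · intro k
      rcases k with - | k
      · simp [gaussTerm]
      · rw [if_neg (Nat.succ_ne_zero k)]
        have hinv : Tendsto (fun n : ℕ => (x * ‖gaussTerm a b x (k + 1)‖) * ((c + n).re)⁻¹) atTop
            (𝓝 0) := by
          have : Tendsto (fun n : ℕ => (c + n).re) atTop atTop := tendsto_atTop.mpr hre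
          simpa using (tendsto_inv_atTop_zero.comp this).const_mul (x * ‖gaussTerm a b x (k + 1)‖)
        refine squeeze_zero_norm' ?_ hinv
        filter_upwards [hre x] with n hn
        have hn0 : 0 < (c + n).re := lt_of_lt_of_le hx0 hn
        have h1 : ‖poch (x : ℂ) (k + 1)‖ * (c + n).re ≤ x * ‖poch (c + n) (k + 1)‖ := by
          rw [poch_succ_left, poch_succ_left, norm_mul, norm_mul, Complex.norm_real,
            Real.norm_of_nonneg hx0.le]
          have h2 := norm_poch_le_of_re_le (x := x + 1) (by positivity) (z := c + n + 1)
            (by simpa using hn) k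
          push_cast at h2
          have h3 := Complex.re_le_norm (c + n)
          calc x * ‖poch ((x : ℂ) + 1) k‖ * (c + n).re ≤
              x * ‖poch (c + n + 1) k‖ * ‖c + n‖ := by gcongr
            _ = _ := by ring
        have h4 : 0 < ‖poch (c + n) (k + 1)‖ :=
          (hpx _).trans_le (norm_poch_le_of_re_le hx0 hn _)
        have h5 := hpx (k + 1)
        have h6 : 0 < ‖((k + 1)! : ℂ)‖ :=
          norm_pos_iff.mpr (Nat.cast_ne_zero.mpr (k + 1).factorial_ne_zero)
        rw [gaussTerm, gaussTerm, norm_div, norm_div, norm_mul (poch (c + n) _), norm_mul (poch x _),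
          ← div_eq_mul_inv, le_div_iff₀ hn0, ← mul_div_assoc, div_mul_eq_mul_div,
          div_le_div_iff₀ (by positivity) (by positivity)]
        calc ‖poch a (k + 1) * poch b (k + 1)‖ * (c + n).re *
              (‖poch (x : ℂ) (k + 1)‖ * ‖((k + 1)! : ℂ)‖) =
            ‖poch a (k + 1) * poch b (k + 1)‖ * ‖((k + 1)! : ℂ)‖ *
              (‖poch (x : ℂ) (k + 1)‖ * (c + n).re) := by ring
          _ ≤ ‖poch a (k + 1) * poch b (k + 1)‖ * ‖((k + 1)! : ℂ)‖ *
              (x * ‖poch (c + n) (k + 1)‖) := by gcongr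
          _ = _ := by ring
    · filter_upwards [hre x] with n hn k
      rw [gaussTerm, gaussTerm, norm_div, norm_div, norm_mul (poch (c + n) _), norm_mul (poch x _)]
      have h6 : 0 < ‖(k ! : ℂ)‖ := norm_pos_iff.mpr (Nat.cast_ne_zero.mpr k.factorial_ne_zero)
      have h5 := hpx k
      have h4 := norm_poch_le_of_re_le hx0 hn k
      gcongr
  simpa using hlim

/-- Gauss's summation theorem. -/
theorem tsum_gaussTerm {a b c : ℂ} (hc : ¬ IsNonposInt c) (hca : ¬ IsNonposInt (c - a))
    (hcb : ¬ IsNonposInt (c - b)) (hcab : ¬ IsNonposInt (c - a - b)) (h : GaussConv a b c) :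
    ∑' k, gaussTerm a b c k = Complex.Gamma c * Complex.Gamma (c - a - b) /
      (Complex.Gamma (c - a) * Complex.Gamma (c - b)) := by
  have h1 : Tendsto (fun n : ℕ => Complex.GammaSeq c n * Complex.GammaSeq (c - a - b) n /
      (Complex.GammaSeq (c - a) n * Complex.GammaSeq (c - b) n) *
        ∑' k, gaussTerm a b (c + (n + 1 : ℕ)) k) atTop
      (𝓝 (Complex.Gamma c * Complex.Gamma (c - a - b) /
      (Complex.Gamma (c - a) * Complex.Gamma (c - b)) * 1)) :=
    (((Complex.GammaSeq_tendsto_Gamma _).mul (Complex.GammaSeq_tendsto_Gamma _)).div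
      ((Complex.GammaSeq_tendsto_Gamma _).mul (Complex.GammaSeq_tendsto_Gamma _))
      (mul_ne_zero (Gamma_ne_zero hca) (Gamma_ne_zero hcb))).mul
      ((tendsto_tsum_gaussTerm a b c).comp (tendsto_add_atTop_nat 1))
  rw [mul_one] at h1
  refine tendsto_nhds_unique (tendsto_const_nhds.congr' ?_) h1
  filter_upwards [eventually_gt_atTop 0] with n hn
  -- The shift is `n + 1` because `GammaSeq s n` has denominator `(s)_{n+1}`; the powers of `n`
  -- cancel.
  rw [gauss_shift hc hcab h (n + 1)]
  congr 1
  have hn' : (n : ℂ) ≠ 0 := by exact_mod_cast hn.ne'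
  have h2 : ∀ s : ℂ, ((n : ℂ) ^ s) ≠ 0 := fun s => by
    rw [Complex.cpow_ne_zero_iff]; exact Or.inl hn'
  have h3 := poch_ne_zero hc (n + 1)
  have h4 := poch_ne_zero hca (n + 1)
  have h5 := poch_ne_zero hcb (n + 1)
  have h6 := poch_ne_zero hcab (n + 1)
  have h7 : (n ! : ℂ) ≠ 0 := Nat.cast_ne_zero.mpr n.factorial_ne_zero
  have h8 : (n : ℂ) ^ c * (n : ℂ) ^ (c - a - b) = (n : ℂ) ^ (c - a) * (n : ℂ) ^ (c - b) := by
    rw [← Complex.cpow_add _ _ hn', ← Complex.cpow_add _ _ hn']; congr 1; ring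
  have h9 := h2 (c - a)
  have h10 := h2 (c - b)
  simp only [GammaSeq_eq]
  rw [div_mul_div_comm, div_mul_div_comm, mul_mul_mul_comm, mul_mul_mul_comm ((n : ℂ) ^ (c - a)), h8]
  field_simp

end Gauss

/-! ### Multiplication by powers of `1 - z` on coefficient sequences. -/

section EulerConv

/-- The coefficients of `(1 - z) ^ (-β)` times the generating function of `u`. -/
noncomputable def eulerConv (u : ℕ → ℂ) (β : ℂ) (k : ℕ) : ℂ :=
  ∑ p ∈ antidiagonal k, u p.1 * (poch β p.2 / (p.2 ! : ℂ))

lemma eulerConv_zero (u : ℕ → ℂ) (β : ℂ) : eulerConv u β 0 = u 0 := by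
  simp [eulerConv]

lemma mk_eulerConv (u : ℕ → ℂ) (β : ℂ) : PowerSeries.mk (eulerConv u β) =
    PowerSeries.mk u * PowerSeries.mk fun i => poch β i / (i ! : ℂ) := by
  ext k
  simp [eulerConv, PowerSeries.coeff_mul]

lemma mk_poch_mul_mk_poch_neg (β : ℂ) :
    (PowerSeries.mk fun i => poch β i / (i ! : ℂ)) *
      (PowerSeries.mk fun i => poch (-β) i / (i ! : ℂ)) = 1 := by
  ext k
  have h := poch_vandermonde β (-β) k
  have hfac := fun n : ℕ => (Nat.cast_ne_zero.mpr n.factorial_ne_zero : (n ! : ℂ) ≠ 0)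
  have hk := hfac k
  have h2 : ∑ p ∈ antidiagonal k, poch β p.1 / (p.1 ! : ℂ) * (poch (-β) p.2 / (p.2 ! : ℂ)) =
      poch (β + -β) k / (k ! : ℂ) := by
    rw [eq_div_iff hk, ← h, Finset.sum_mul]
    refine Finset.sum_congr rfl fun p hp => ?_
    rw [← HasAntidiagonal.mem_antidiagonal.mp hp, Nat.cast_add_choose]
    have := hfac p.1
    have := hfac p.2
    field_simp
  simp only [PowerSeries.coeff_mul, PowerSeries.coeff_mk, PowerSeries.coeff_one, h2,
    add_neg_cancel]
  split_ifs with hk0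
  · subst hk0; simp
  · rw [poch_zero_left hk0, zero_div]

lemma eulerConv_eulerConv_neg (u : ℕ → ℂ) (β : ℂ) : eulerConv (eulerConv u (-β)) β = u := by
  have h : PowerSeries.mk (eulerConv (eulerConv u (-β)) β) = PowerSeries.mk u := by
    rw [mk_eulerConv, mk_eulerConv, mul_assoc, mul_comm (PowerSeries.mk _),
      mul_comm (PowerSeries.mk fun i => poch (-β) i / (i ! : ℂ)), mk_poch_mul_mk_poch_neg, one_mul]
  funext k
  simpa using congrArg (PowerSeries.coeff k) h

end EulerConv

/-! ### The double series summed by rows and by antidiagonals. -/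

section DoubleSeries

/-- The double series whose two iterated sums are compared in `tsum_eulerConv`. -/
noncomputable def doubleTerm (u : ℕ → ℂ) (β d E : ℂ) (p : ℕ × ℕ) : ℂ :=
  u p.1 * (poch β p.2 / (p.2 ! : ℂ)) * (poch d (p.1 + p.2) / poch E (p.1 + p.2))

lemma doubleTerm_eq (u : ℕ → ℂ) (β d E : ℂ) (l i : ℕ) :
    doubleTerm u β d E (l, i) =
      u l * (poch d l / poch E l) * gaussTerm β (d + l) (E + l) i := by
  rw [doubleTerm, gaussTerm, poch_add, poch_add]
  simp only [div_eq_mul_inv, mul_inv]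
  ring

/-- If `d = -N`, a nonzero `(d)_l` forces `l ≤ N`, so the shifted series still terminates. -/
lemma GaussConv.shift {β d E : ℂ} (h : GaussConv β d E) {l : ℕ} (hl : poch d l ≠ 0) :
    GaussConv β (d + l) (E + l) := by
  rcases h with h | h | ⟨N, rfl⟩
  · left
    rwa [show E + l - β - (d + l) = E - β - d by ring]
  · exact Or.inr (Or.inl h)
  · refine Or.inr (Or.inr ⟨N - l, ?_⟩)
    have : l ≤ N := by
      by_contra hlt
      exact hl (poch_neg_nat_eq_zero (by omega))
    rw [Nat.cast_sub this]; ring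

/-- Antidiagonals give the convolution; row `l` is a Gauss series whose Gamma quotient turns `(E)_l`
into `(E - β)_l`. Rows with `(d)_l = 0` vanish and are treated apart, as the shifted Gauss condition
may fail there. -/
theorem tsum_eulerConv {u : ℕ → ℂ} {β d E : ℂ} (hE : ¬ IsNonposInt E)
    (hEβ : ¬ IsNonposInt (E - β)) (hEd : ¬ IsNonposInt (E - d))
    (hEβd : ¬ IsNonposInt (E - β - d)) (hG : GaussConv β d E)
    (hs : Summable (doubleTerm u β d E)) :
    ∑' k, eulerConv u β k * (poch d k / poch E k) =
      Complex.Gamma E * Complex.Gamma (E - β - d) /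
        (Complex.Gamma (E - β) * Complex.Gamma (E - d)) *
        ∑' l, u l * (poch d l / poch (E - β) l) := by
  have h1 : ∑' p, doubleTerm u β d E p = ∑' k, eulerConv u β k * (poch d k / poch E k) := by
    have hs' := HasAntidiagonal.sigmaAntidiagonalEquivProd.summable_iff.mpr hs
    rw [← HasAntidiagonal.sigmaAntidiagonalEquivProd.tsum_eq (doubleTerm u β d E)]
    refine (hs'.tsum_sigma' fun n => (hasSum_fintype _).summable).trans (tsum_congr fun k => ?_)
    rw [tsum_fintype, eulerConv, Finset.sum_mul]
    refine (Finset.sum_coe_sort (antidiagonal k) (fun p => doubleTerm u β d E p)).trans ?_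
    refine Finset.sum_congr rfl fun p hp => ?_
    rw [doubleTerm, HasAntidiagonal.mem_antidiagonal.mp hp]
  rw [← h1, hs.tsum_prod, ← tsum_mul_left]
  refine tsum_congr fun l => ?_
  simp only [doubleTerm_eq, tsum_mul_left]
  by_cases hl : poch d l = 0
  · rw [hl]; simp
  · have h2 := not_isNonposInt_add_nat hE l
    have h3 := not_isNonposInt_add_nat hEβ l
    rw [tsum_gaussTerm h2 (by rwa [add_sub_right_comm]) (by rwa [add_sub_add_right_eq_sub])
      (by rwa [show E + l - β - (d + l) = E - β - d by ring]) (hG.shift hl),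
      show E + l - β - (d + l) = E - β - d by ring, add_sub_right_comm, add_sub_add_right_eq_sub,
      Gamma_add_nat hE, Gamma_add_nat hEβ]
    have h4 := poch_ne_zero hE l
    have h5 := poch_ne_zero hEβ l
    have h6 := Gamma_ne_zero hEβ
    have h7 := Gamma_ne_zero hEd
    field_simp

lemma summable_doubleTerm_of_finite {u : ℕ → ℂ} {β d E : ℂ} (hE : ¬ IsNonposInt E)
    (hG : GaussConv β d E) {N : ℕ} (hu : ∀ l, N < l → u l = 0) :
    Summable (doubleTerm u β d E) := by
  refine Summable.of_norm ((summable_prod_of_nonneg fun _ => norm_nonneg _).mpr ⟨fun l => ?_, ?_⟩)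
  · simp only [doubleTerm_eq, norm_mul]
    by_cases hl : poch d l = 0
    · simp [hl, summable_zero]
    · exact (gaussTerm_summable_norm (not_isNonposInt_add_nat hE l) (hG.shift hl)).mul_left _
  · refine summable_of_ne_finset_zero (s := range (N + 1)) fun l hl => ?_
    simp [doubleTerm, hu l (by simpa using hl)]

lemma summable_doubleTerm_of_neg_nat (u : ℕ → ℂ) (β E : ℂ) (N : ℕ) :
    Summable (doubleTerm u β (-(N : ℂ)) E) := by
  refine summable_of_ne_finset_zero (s := range (N + 1) ×ˢ range (N + 1)) fun p hp => ?_
  rw [doubleTerm, poch_neg_nat_eq_zero (n := N), zero_div, mul_zero]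
  simp only [Finset.mem_product, Finset.mem_range] at hp
  omega

/-- With `p = Re β`, `σ = Re (E - d)` and `ε = (σ - p) / 2`, share the decay `(l + i + 1)^{-σ}` as
`(l + 1)^{-ε} (i + 1)^{-(σ - ε)}`. The exponents become `-p - 1 - ε` and `-1 - ε`, both below `-1`.
-/
lemma summable_doubleTerm_of_bound {u : ℕ → ℂ} {β d E : ℂ} (hE : ¬ IsNonposInt E)
    (hβ : 0 ≤ β.re) (hd : β.re < (E - d).re) {K : ℝ} (hK : 0 ≤ K)
    (hu : ∀ l, ‖u l‖ ≤ K * ((l : ℝ) + 1) ^ (-β.re - 1)) :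
    Summable (doubleTerm u β d E) := by
  obtain ⟨K₁, hK₁, h1⟩ := norm_poch_div_factorial_le β
  obtain ⟨K₂, hK₂, h2⟩ := norm_poch_div_poch_le d hE
  set σ := (E - d).re with hσ
  set p := β.re with hp
  set ε := (σ - p) / 2 with hε
  have hε0 : 0 < ε := by linarith
  have hs1 := summable_nat_add_one_rpow (show -p - 1 - ε < -1 by linarith)
  have hs2 := summable_nat_add_one_rpow (show p - 1 - (σ - ε) < -1 by linarith)
  refine Summable.of_norm_bounded ((hs1.mul_of_nonneg hs2 (fun _ => by positivity)
    (fun _ => by positivity)).mul_left (K * K₁ * K₂)) fun x => ?_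
  obtain ⟨l, i⟩ := x
  have hl : (0 : ℝ) < (l : ℝ) + 1 := by positivity
  have hi : (0 : ℝ) < (i : ℝ) + 1 := by positivity
  have hli : (0 : ℝ) < ((l + i : ℕ) : ℝ) + 1 := by positivity
  have hpow : (((l + i : ℕ) : ℝ) + 1) ^ (d.re - E.re) ≤
      ((l : ℝ) + 1) ^ (-ε) * ((i : ℝ) + 1) ^ (-(σ - ε)) := by
    rw [show d.re - E.re = -ε + -(σ - ε) by simp [hσ]; ring, Real.rpow_add hli]
    have e1 : (l : ℝ) + 1 ≤ ((l + i : ℕ) : ℝ) + 1 := by push_cast; linarith [Nat.cast_nonneg (α := ℝ) i]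
    have e2 : (i : ℝ) + 1 ≤ ((l + i : ℕ) : ℝ) + 1 := by push_cast; linarith [Nat.cast_nonneg (α := ℝ) l]
    exact mul_le_mul (Real.rpow_le_rpow_of_nonpos hl e1 (by linarith))
      (Real.rpow_le_rpow_of_nonpos hi e2 (by linarith)) (by positivity) (by positivity)
  rw [doubleTerm, norm_mul, norm_mul]
  calc ‖u l‖ * ‖poch β i / (i ! : ℂ)‖ * ‖poch d (l + i) / poch E (l + i)‖ ≤
      (K * ((l : ℝ) + 1) ^ (-p - 1)) * (K₁ * ((i : ℝ) + 1) ^ (p - 1)) *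
        (K₂ * (((l : ℝ) + 1) ^ (-ε) * ((i : ℝ) + 1) ^ (-(σ - ε)))) := by
        refine mul_le_mul (mul_le_mul (hu l) (h1 i) (norm_nonneg _) (by positivity))
          ((h2 _).trans (mul_le_mul_of_nonneg_left hpow hK₂)) (norm_nonneg _) (by positivity)
    _ = K * K₁ * K₂ * (((l : ℝ) + 1) ^ (-p - 1 - ε) * ((i : ℝ) + 1) ^ (p - 1 - (σ - ε))) := by
        rw [sub_eq_add_neg (-p - 1) ε, Real.rpow_add hl, sub_eq_add_neg (p - 1) (σ - ε),
          Real.rpow_add hi]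
        ring

end DoubleSeries

/-! ### Convergence criteria for the single series. -/

section Summability

lemma summable_mul_poch_div {v : ℕ → ℂ} {d E : ℂ} (hE : ¬ IsNonposInt E) {K p : ℝ}
    (hv : ∀ k, ‖v k‖ ≤ K * ((k : ℝ) + 1) ^ (p - 1)) (hp : p < (E - d).re) :
    Summable fun k => v k * (poch d k / poch E k) := by
  obtain ⟨K', hK', h⟩ := norm_poch_div_poch_le d hE
  have hK : 0 ≤ K := by simpa using (norm_nonneg _).trans (hv 0)
  have hs := summable_nat_add_one_rpow (show p - 1 + (d.re - E.re) < -1 by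
    rw [Complex.sub_re] at hp; linarith)
  refine Summable.of_norm_bounded (hs.mul_left (K * K')) fun k => ?_
  rw [norm_mul]
  refine (mul_le_mul (hv k) (h k) (norm_nonneg _) (by positivity)).trans (le_of_eq ?_)
  rw [Real.rpow_add (by positivity)]; ring

lemma summable_of_eq_zero_of_lt {v : ℕ → ℂ} {N : ℕ} (h : ∀ k, N < k → v k = 0) : Summable v :=
  summable_of_ne_finset_zero (s := range (N + 1)) fun k hk => h k (by simpa using hk)

/-- The growth of the terms `(x)_k Q(k) / (y)_k` for a polynomial `Q`. -/
lemma norm_poch_div_poch_mul_eval_le (x : ℂ) {y : ℂ} (hy : ¬ IsNonposInt y) (Q : ℂ[X]) {D : ℕ}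
    (hQ : Q.natDegree ≤ D) (s : ℂ) : ∃ K : ℝ, 0 ≤ K ∧ ∀ k : ℕ,
      ‖poch x k / poch y k * Q.eval (s * k)‖ ≤ K * ((k : ℝ) + 1) ^ (x.re - y.re + D) := by
  obtain ⟨K₁, hK₁, h1⟩ := norm_poch_div_poch_le x hy
  obtain ⟨K₂, hK₂, h2⟩ := norm_eval_natCast_le Q hQ s
  refine ⟨K₁ * K₂, by positivity, fun k => ?_⟩
  rw [norm_mul]
  refine (mul_le_mul (h1 k) (h2 k) (norm_nonneg _) (by positivity)).trans (le_of_eq ?_)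
  rw [Real.rpow_add (by positivity)]; ring

end Summability

/-! ### The nonterminating transformation. -/

section NonTerminating

variable {r : ℕ} (f : Fin r → ℂ) (m : Fin r → ℕ)

lemma poly3F2_natDegree_le (N : ℕ) (s u v w : ℂ) : (poly3F2 N s u v w).natDegree ≤ N := by
  refine natDegree_sum_le_of_forall_le _ _ fun j hj => (natDegree_C_mul_le _ _).trans ?_
  rw [natDegree_comp, ascPochhammer_natDegree, natDegree_X_add_C, mul_one]
  simpa [Nat.lt_succ_iff] using hj

lemma Rhat_natDegree_le {N : ℕ} (hN : ∑ i, m i = N + 1) (a b : ℂ) :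
    (Rhat f m a b).natDegree ≤ N := by
  rw [Rhat, hN]
  refine natDegree_add_le_of_degree_le
    ((natDegree_C_mul_le _ _).trans (poly3F2_natDegree_le _ _ _ _ _)) ?_
  refine natDegree_sum_le_of_forall_le _ _ fun k hk => ?_
  obtain ⟨hk1, hk2⟩ := Finset.mem_Icc.mp hk
  refine natDegree_mul_le.trans ((add_le_add ((natDegree_C_mul_le _ _).trans le_rfl)
    (poly3F2_natDegree_le _ _ _ _ _)).trans ?_)
  rw [natDegree_comp, ascPochhammer_natDegree, ← C_1, natDegree_X_add_C]
  omega

/-- The quotient of the roots' contributions to the terms is a polynomial in the index. -/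
lemma exists_roots_quotient (Q : ℂ[X]) {D : ℕ} (hQ : Q.natDegree ≤ D)
    (hroots : ∀ g ∈ Q.roots, ¬ IsNonposInt (g + 1)) :
    ∃ q : ℂ[X], q.natDegree ≤ D ∧ ∀ k : ℕ,
      (Q.roots.map fun g => poch (g + 2) k).prod / (Q.roots.map fun g => poch (g + 1) k).prod =
        q.eval (-1 * (k : ℂ)) ∧ Q.eval (-1) * q.eval (-1 * (k : ℂ)) = Q.eval (-((k + 1 : ℕ) : ℂ)) := by
  -- For `Q = 0` the root products are empty, so `q = 1` serves. Otherwise `-1` is not a root and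
  -- `q(t) = Q(t - 1) / Q(-1)`.
  by_cases h0 : Q = 0
  · exact ⟨1, by simp, fun k => by simp [h0]⟩
  · have h1 : Q.eval (-1) ≠ 0 := fun h =>
      hroots (-1) ((mem_roots h0).mpr h) ⟨0, by simp⟩
    refine ⟨C (Q.eval (-1))⁻¹ * Q.comp (X - C 1), (natDegree_C_mul_le _ _).trans ?_, fun k => ?_⟩
    · rw [natDegree_comp, natDegree_X_sub_C, mul_one]; exact hQ
    · have h2 : (Q.roots.map fun g => poch (g + 1) k).prod ≠ 0 := by
        refine Multiset.prod_ne_zero fun h => ?_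
        obtain ⟨g, hg, hg0⟩ := Multiset.mem_map.mp h
        exact poch_ne_zero (hroots g hg) k hg0
      have h3 := prod_poch_roots Q 1 k
      have h4 : (C (Q.eval (-1))⁻¹ * Q.comp (X - C 1)).eval (-1 * (k : ℂ)) =
          (Q.eval (-1))⁻¹ * Q.eval (-((k + 1 : ℕ) : ℂ)) := by
        rw [eval_mul, eval_C, eval_comp, eval_sub, eval_X, eval_C]
        congr 2; push_cast; ring
      rw [show (1 : ℂ) + 1 = 2 by norm_num,
        show (-1 : ℂ) - k = -((k + 1 : ℕ) : ℂ) by push_cast; ring] at h3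
      rw [h4]
      refine ⟨?_, by field_simp⟩
      rw [div_eq_iff h2]
      field_simp
      linear_combination h3

theorem thomae_nonterminating {M : ℕ} (hM : ∑ i, m i = M) (hM1 : 1 ≤ M) {a b d e : ℂ}
    (ha : ¬ IsNonposInt (a + M)) (hab : ∀ j : ℕ, j < M → a - b ≠ -(j : ℂ))
    (hf : ∀ i, ¬ IsNonposInt (f i)) (he : ¬ IsNonposInt e) (heb : ¬ IsNonposInt (e - b))
    (hed : ¬ IsNonposInt (e - d)) (hebd : ¬ IsNonposInt (e - b - d))
    (hroots : ∀ g ∈ (Rhat f m a b).roots, ¬ IsNonposInt (g + 1))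
    (hl : 0 < (e - b - d).re ∨ IsNonposInt a ∨ IsNonposInt b ∨ IsNonposInt d)
    (hr : 0 < (e - d).re ∨ IsNonposInt (a - b + 1) ∨ IsNonposInt (d + 1)) :
    Summable (hypTerm ({a, b, d} + params (fun i => f i + (m i : ℂ)))
      ({a + (M : ℂ), e} + params f) 1) ∧
    Summable (hypTerm ({1, a - b + 1, d + 1} + (Rhat f m a b).roots.map (fun g => g + 2))
      ({a + (M : ℂ) + 1, e - b + 1} + (Rhat f m a b).roots.map (fun g => g + 1)) 1) ∧
    Complex.Gamma (e - d) * Complex.Gamma (e - b) / (Complex.Gamma e * Complex.Gamma (e - b - d)) *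
        hyp ({a, b, d} + params (fun i => f i + (m i : ℂ))) ({a + (M : ℂ), e} + params f) 1 =
      1 + b * d / (e - b) * (a * (∏ i, (f i + (m i : ℂ))) / ((a + (M : ℂ)) * ∏ i, f i) - 1) *
        hyp ({1, a - b + 1, d + 1} + (Rhat f m a b).roots.map (fun g => g + 2))
          ({a + (M : ℂ) + 1, e - b + 1} + (Rhat f m a b).roots.map (fun g => g + 1)) 1 := by
  obtain ⟨N, rfl⟩ := Nat.exists_eq_add_of_le' hM1
  have hP : pochVec f m ≠ 0 := Finset.prod_ne_zero_iff.mpr fun i _ => poch_ne_zero (hf i) _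
  have hf0 : ∀ i, f i ≠ 0 := fun i h => hf i ⟨0, by simpa using h⟩
  set h : ℕ → ℂ := fun k => poch a k * poch b k / (poch (a + (N + 1 : ℕ)) k * (k ! : ℂ)) *
    ((sigmaPoly f m).eval (k : ℂ) / pochVec f m) with hh
  set c : ℕ → ℂ := eulerConv h (-b) with hc
  have hc0 : c 0 = 1 := by
    rw [hc, eulerConv_zero]; simp [hh, sigmaPoly_eval_zero, hP]
  have hcl : ∀ l, 1 ≤ l → c l =
      -poch (a - b) l / poch (a + (N + 1 : ℕ)) l * (Rhat f m a b).eval (-(l : ℂ)) :=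
    fun l hl => sum_euler_sigmaPoly f m hM hM1 hP ha hab hl
  have hcb : eulerConv c b = h := eulerConv_eulerConv_neg h b
  have hleft : ∀ k, hypTerm ({a, b, d} + params (fun i => f i + (m i : ℂ)))
      ({a + ((N + 1 : ℕ) : ℂ), e} + params f) 1 k = h k * (poch d k / poch e k) := by
    intro k
    rw [hypTerm_params f m _ _ _ (fun i => poch_ne_zero (hf i) k) hP, hypTerm_three_two, hh]
    simp only [div_eq_mul_inv, mul_inv]
    ring
  obtain ⟨q, hqdeg, hq⟩ := exists_roots_quotient (Rhat f m a b) (Rhat_natDegree_le f m hM a b) hroots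
  have hright : ∀ k, hypTerm ({1, a - b + 1, d + 1} + (Rhat f m a b).roots.map (fun g => g + 2))
      ({a + ((N + 1 : ℕ) : ℂ) + 1, e - b + 1} + (Rhat f m a b).roots.map (fun g => g + 1)) 1 k =
      poch (a - b + 1) k / poch (a + (N + 1 : ℕ) + 1) k * q.eval (-1 * (k : ℂ)) *
        (poch (d + 1) k / poch (e - b + 1) k) := by
    intro k
    have : (k ! : ℂ) ≠ 0 := Nat.cast_ne_zero.mpr k.factorial_ne_zero
    rw [hypTerm_add, hypTerm_three_two, Multiset.map_map, Multiset.map_map]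
    simp only [Function.comp_def]
    rw [(hq k).1, poch_one_left]
    field_simp
  have ha1 := not_isNonposInt_add_one ha
  have heb1 := not_isNonposInt_add_one heb
  -- growth of the coefficients
  obtain ⟨Kh, hKh, hhb⟩ : ∃ K : ℝ, 0 ≤ K ∧ ∀ k, ‖h k‖ ≤ K * ((k : ℝ) + 1) ^ (b.re - 1) := by
    obtain ⟨K₁, hK₁, h1⟩ := norm_poch_div_poch_mul_eval_le a ha (sigmaPoly f m)
      (sigmaPoly_natDegree f m).le 1
    obtain ⟨K₂, hK₂, h2⟩ := norm_poch_div_factorial_le b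
    refine ⟨K₁ * K₂ / ‖pochVec f m‖, by positivity, fun k => ?_⟩
    have h3 : h k = (poch a k / poch (a + (N + 1 : ℕ)) k * (sigmaPoly f m).eval (1 * (k : ℂ))) *
        (poch b k / (k ! : ℂ)) / pochVec f m := by
      rw [hh, one_mul]
      simp only [div_eq_mul_inv, mul_inv]
      ring
    rw [h3, norm_div, norm_mul, div_mul_eq_mul_div (K₁ * K₂)]
    refine div_le_div_of_nonneg_right ?_ (norm_nonneg _)
    refine (mul_le_mul (h1 k) (h2 k) (norm_nonneg _) (by positivity)).trans (le_of_eq ?_)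
    rw [mul_mul_mul_comm, ← Real.rpow_add (by positivity), hM]
    congr 2
    simp
  obtain ⟨Kc, hKc, hcbd⟩ : ∃ K : ℝ, 0 ≤ K ∧ ∀ k, ‖c k‖ ≤ K * ((k : ℝ) + 1) ^ (-b.re - 1) := by
    obtain ⟨K₁, hK₁, h1⟩ := norm_poch_div_poch_mul_eval_le (a - b) ha (Rhat f m a b)
      (Rhat_natDegree_le f m hM a b) (-1)
    -- The `1` covers `c 0 = 1`, to which the formula through `R̂` does not apply.
    refine ⟨max K₁ 1, by positivity, fun k => ?_⟩
    rcases Nat.eq_zero_or_pos k with rfl | hk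
    · simp [hc0]
    · rw [hcl k hk, neg_div, neg_mul, norm_neg]
      have h2 := h1 k
      rw [neg_one_mul] at h2
      refine h2.trans ?_
      rw [show (a - b).re - (a + (N + 1 : ℕ)).re + N = -b.re - 1 by simp; ring]
      exact mul_le_mul_of_nonneg_right (le_max_left _ _) (by positivity)
  have hqs : 0 < (e - d).re → Summable fun k : ℕ => poch (a - b + 1) k /
      poch (a + (N + 1 : ℕ) + 1) k * q.eval (-1 * (k : ℂ)) *
        (poch (d + 1) k / poch (e - b + 1) k) := by
    intro hpos
    obtain ⟨K₁, hK₁, h1⟩ := norm_poch_div_poch_mul_eval_le (a - b + 1) ha1 q hqdeg (-1)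
    refine summable_mul_poch_div heb1 (p := -b.re) (K := K₁) (fun k => ?_) ?_
    · refine (h1 k).trans (le_of_eq ?_)
      congr 2
      simp; ring
    · simp at hpos ⊢; linarith
  -- vanishing of the coefficients
  have hha : ∀ n : ℕ, a = -(n : ℂ) → ∀ k, n < k → h k = 0 := by
    intro n hn k hk
    rw [hh]; simp only [hn, poch_neg_nat_eq_zero hk]; simp
  have hhb0 : ∀ n : ℕ, b = -(n : ℂ) → ∀ k, n < k → h k = 0 := by
    intro n hn k hk
    rw [hh]; simp only [hn, poch_neg_nat_eq_zero hk]; simp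
  have hcf : ∀ n : ℕ, a - b + 1 = -(n : ℂ) → ∀ k, n + 1 < k → c k = 0 := by
    intro n hn k hk
    rw [hcl k (by omega), show a - b = -((n + 1 : ℕ) : ℂ) by push_cast; linear_combination hn,
      poch_neg_nat_eq_zero hk]
    simp
  have hd1 : IsNonposInt (d + 1) → IsNonposInt d := fun ⟨n, hn⟩ =>
    ⟨n + 1, by push_cast; linear_combination hn⟩
  -- both series converge
  have hsl : Summable fun k => h k * (poch d k / poch e k) := by
    rcases hl with h1 | ⟨n, hn⟩ | ⟨n, hn⟩ | ⟨n, hn⟩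
    · exact summable_mul_poch_div he hhb (by simp at h1 ⊢; linarith)
    · exact summable_of_eq_zero_of_lt fun k hk => by rw [hha n hn k hk, zero_mul]
    · exact summable_of_eq_zero_of_lt fun k hk => by rw [hhb0 n hn k hk, zero_mul]
    · exact summable_of_eq_zero_of_lt (N := n) fun k hk => by
        rw [hn, poch_neg_nat_eq_zero hk]; simp
  have hsr : Summable fun k : ℕ => poch (a - b + 1) k /
      poch (a + (N + 1 : ℕ) + 1) k * q.eval (-1 * (k : ℂ)) *
        (poch (d + 1) k / poch (e - b + 1) k) := by
    rcases hr with h1 | ⟨n, hn⟩ | ⟨n, hn⟩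
    · exact hqs h1
    · exact summable_of_eq_zero_of_lt (N := n) fun k hk => by
        rw [hn, poch_neg_nat_eq_zero hk]; simp
    · exact summable_of_eq_zero_of_lt (N := n) fun k hk => by
        rw [hn, poch_neg_nat_eq_zero hk]; simp
  -- the transformation
  have hII : e - b - -b = e := by ring
  have hII' : e - b - -b - d = e - d := by ring
  have hg1 := Gamma_ne_zero he
  have hg2 := Gamma_ne_zero heb
  have hg3 := Gamma_ne_zero hed
  have hg4 := Gamma_ne_zero hebd
  -- The same identity from two double series: `dirI` expands `h` through `c`, `dirII` expands `c`
  -- through `h`, with `β = -b` and `E = e - b`.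
  have dirI : GaussConv b d e → Summable (doubleTerm c b d e) →
      Complex.Gamma (e - d) * Complex.Gamma (e - b) / (Complex.Gamma e * Complex.Gamma (e - b - d)) *
        ∑' k, h k * (poch d k / poch e k) = ∑' l, c l * (poch d l / poch (e - b) l) := by
    intro hG hs
    have := tsum_eulerConv he heb hed hebd hG hs
    rw [hcb] at this
    rw [this]
    field_simp
  have dirII : GaussConv (-b) d (e - b) → Summable (doubleTerm h (-b) d (e - b)) →
      Complex.Gamma (e - d) * Complex.Gamma (e - b) / (Complex.Gamma e * Complex.Gamma (e - b - d)) *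
        ∑' k, h k * (poch d k / poch e k) = ∑' l, c l * (poch d l / poch (e - b) l) := by
    intro hG hs
    have := tsum_eulerConv heb (by rwa [hII]) hebd (by rwa [hII']) hG hs
    rw [hII', hII] at this
    rw [hc, this]
    congr 1
    ring
  have main : Complex.Gamma (e - d) * Complex.Gamma (e - b) /
      (Complex.Gamma e * Complex.Gamma (e - b - d)) *
        ∑' k, h k * (poch d k / poch e k) = ∑' l, c l * (poch d l / poch (e - b) l) := by
    -- If `d ∈ -ℕ₀` the double series is finite. Otherwise a finite `h` favours `dirII` and a finite
    -- `c` favours `dirI`; with neither, the sign of `Re b` selects the direction with `Re β ≥ 0`.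
    by_cases hd : IsNonposInt d
    · refine dirI (Or.inr (Or.inr hd)) ?_
      obtain ⟨n, rfl⟩ := hd
      exact summable_doubleTerm_of_neg_nat _ _ _ n
    · rcases hr with h1 | ⟨n, hn⟩ | h1
      · have hG : GaussConv (-b) d (e - b) := Or.inl (by rwa [hII'])
        rcases hl with h2 | ⟨n, hn⟩ | ⟨n, hn⟩ | h2
        · rcases le_or_gt 0 b.re with hb | hb
          · exact dirI (Or.inl h2) (summable_doubleTerm_of_bound he hb
              (by simp at h2 ⊢; linarith) hKc hcbd)
          · exact dirII hG (summable_doubleTerm_of_bound heb (by simp; linarith)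
              (by simp at h1 ⊢; linarith) hKh (by simpa using hhb))
        · exact dirII hG (summable_doubleTerm_of_finite heb hG (hha n hn))
        · exact dirII hG (summable_doubleTerm_of_finite heb hG (hhb0 n hn))
        · exact absurd h2 hd
      · have hI : GaussConv b d e → _ := fun hG =>
          dirI hG (summable_doubleTerm_of_finite he hG (hcf n hn))
        rcases hl with h2 | ⟨n', hn'⟩ | h2 | h2
        · exact hI (Or.inl h2)
        · rcases le_or_gt (n + 1) n' with hle | hlt
          · refine hI (Or.inr (Or.inl ⟨n' - (n + 1), ?_⟩))
            rw [Nat.cast_sub hle]; push_cast; linear_combination hn' - hn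
          · have hG : GaussConv (-b) d (e - b) := by
              refine Or.inr (Or.inl ⟨n + 1 - n', ?_⟩)
              rw [Nat.cast_sub hlt.le]; push_cast; linear_combination hn - hn'
            exact dirII hG (summable_doubleTerm_of_finite heb hG (hha n' hn'))
        · exact hI (Or.inr (Or.inl h2))
        · exact absurd h2 hd
      · exact absurd (hd1 h1) hd
  refine ⟨by simpa only [funext hleft] using hsl, by simpa only [funext hright] using hsr, ?_⟩
  set κ := a * (∏ i, (f i + (m i : ℂ))) / ((a + ((N + 1 : ℕ) : ℂ)) * ∏ i, f i) - 1 with hκ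
  have hRm := Rhat_eval_neg_one f m hM hM1 hP ha hab hf0
  rw [← hκ] at hRm
  -- Splitting off the first factor of each rising factorial raises the parameters by one; `R̂(-1)`,
  -- pulled out of `R̂(-(k + 1))`, supplies `κ`.
  have hterm : ∀ k : ℕ, c (k + 1) * (poch d (k + 1) / poch (e - b) (k + 1)) =
      b * d / (e - b) * κ * (poch (a - b + 1) k / poch (a + (N + 1 : ℕ) + 1) k *
        q.eval (-1 * (k : ℂ)) * (poch (d + 1) k / poch (e - b + 1) k)) := by
    intro k
    have h1 := poch_ne_zero ha1 k
    have h2 := poch_ne_zero heb1 k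
    have h3 : a + ((N + 1 : ℕ) : ℂ) ≠ 0 := fun h => ha ⟨0, by simpa using h⟩
    have h4 : e - b ≠ 0 := fun h => heb ⟨0, by simpa using h⟩
    rw [hcl (k + 1) (by omega), ← (hq k).2]
    simp only [poch_succ_left]
    generalize q.eval (-1 * (k : ℂ)) = S
    clear_value κ
    field_simp
    linear_combination (-d * poch (a - b + 1) k * S * poch (d + 1) k) * hRm
  have hsc : Summable fun l => c l * (poch d l / poch (e - b) l) := by
    rw [← summable_nat_add_iff 1]
    simp only [hterm]
    exact hsr.mul_left _
  rw [hyp, hyp, tsum_congr hleft, tsum_congr hright, main, hsc.tsum_eq_zero_add, hc0, poch_zero,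
    poch_zero, tsum_congr hterm, tsum_mul_left]
  simp

end NonTerminating

end ThomaeHyp

theorem corollary7 {r : ℕ} (hr : 1 ≤ r) (f : Fin r → ℂ) (m : Fin r → ℕ) (hm : ∀ i, 1 ≤ m i)
    (M : ℕ) (hM : M = ∑ i, m i) :
    (∀ (n : ℕ) (b d e : ℂ),
      ¬ ThomaeHyp.IsNonposInt (b + M) →
      (r = 1 → M = 1 → ∀ i, f i ≠ b) →
      (∀ i, ThomaeHyp.poch (f i) n ≠ 0 ∧ ThomaeHyp.poch (f i) (m i) ≠ 0) →
      ThomaeHyp.poch e n ≠ 0 →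
      ThomaeHyp.poch (e - d) n ≠ 0 →
      (∀ l ∈ (ThomaeHyp.R f m b).roots, ThomaeHyp.poch l n ≠ 0) →
      ThomaeHyp.poch e n / ThomaeHyp.poch (e - d) n *
          ThomaeHyp.hyp
            ({-(n : ℂ), b, d} + ThomaeHyp.params (fun i => f i + (m i : ℂ)))
            ({b + (M : ℂ), e} + ThomaeHyp.params f) 1 =
        ThomaeHyp.poch b M / ThomaeHyp.pochVec f m +
          (1 - ThomaeHyp.poch b M / ThomaeHyp.pochVec f m) *
            ThomaeHyp.hyp
              ({-(n : ℂ), 1, d} + (ThomaeHyp.R f m b).roots.map (fun l => l + 1))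
              ({b + (M : ℂ), 1 - e + d - (n : ℂ)} + (ThomaeHyp.R f m b).roots) 1) ∧
    (∀ a b d e : ℂ,
      ¬ ThomaeHyp.IsNonposInt (a + M) →
      (∀ j : ℕ, j < M → a - b ≠ -(j : ℂ)) →
      (r = 1 → M = 1 → ∀ i, f i ≠ a) →
      (∀ i, ¬ ThomaeHyp.IsNonposInt (f i)) →
      ¬ ThomaeHyp.IsNonposInt e →
      ¬ ThomaeHyp.IsNonposInt (e - b) →
      ¬ ThomaeHyp.IsNonposInt (e - d) →
      ¬ ThomaeHyp.IsNonposInt (e - b - d) →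
      (∀ g ∈ (ThomaeHyp.Rhat f m a b).roots, ¬ ThomaeHyp.IsNonposInt (g + 1)) →
      (0 < (e - b - d).re ∨ ThomaeHyp.IsNonposInt a ∨ ThomaeHyp.IsNonposInt b ∨
        ThomaeHyp.IsNonposInt d) →
      (0 < (e - d).re ∨ ThomaeHyp.IsNonposInt (a - b + 1) ∨ ThomaeHyp.IsNonposInt (d + 1)) →
      Summable (ThomaeHyp.hypTerm
        ({a, b, d} + ThomaeHyp.params (fun i => f i + (m i : ℂ)))
        ({a + (M : ℂ), e} + ThomaeHyp.params f) 1) ∧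
      Summable (ThomaeHyp.hypTerm
        ({1, a - b + 1, d + 1} + (ThomaeHyp.Rhat f m a b).roots.map (fun g => g + 2))
        ({a + (M : ℂ) + 1, e - b + 1} + (ThomaeHyp.Rhat f m a b).roots.map (fun g => g + 1)) 1) ∧
      Complex.Gamma (e - d) * Complex.Gamma (e - b) /
            (Complex.Gamma e * Complex.Gamma (e - b - d)) *
          ThomaeHyp.hyp
            ({a, b, d} + ThomaeHyp.params (fun i => f i + (m i : ℂ)))
            ({a + (M : ℂ), e} + ThomaeHyp.params f) 1 =
        1 + b * d / (e - b) *
            (a * (∏ i, (f i + (m i : ℂ))) / ((a + (M : ℂ)) * ∏ i, f i) - 1) *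
            ThomaeHyp.hyp
              ({1, a - b + 1, d + 1} + (ThomaeHyp.Rhat f m a b).roots.map (fun g => g + 2))
              ({a + (M : ℂ) + 1, e - b + 1} +
                (ThomaeHyp.Rhat f m a b).roots.map (fun g => g + 1)) 1) := by
  have hM1 : 1 ≤ M := by
    rw [hM]
    exact (hm ⟨0, hr⟩).trans (Finset.single_le_sum (f := m) (fun _ _ => Nat.zero_le _)
      (Finset.mem_univ _))
  exact ⟨fun n b d e hb _ hf he hed hR =>
      ThomaeHyp.thomae_terminating f m hM.symm hM1 n b d e hb hf he hed hR,
    fun a b d e ha hab _ hf he heb hed hebd hroots hl hr' =>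
      ThomaeHyp.thomae_nonterminating f m hM.symm hM1 ha hab hf he heb hed hebd hroots hl hr'⟩
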